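/- **Conventions.** A *theory* $T$ consists of sets $T(n)$ ($n\ge 0$), a functorial action $w\mapsto w_f$ of all maps $f:\{1,\dots,m\}\to\{1,\dots,n\}$ as maps $T(m)\to T(n)$, compositions $\gamma:T(k)\times T(n_1)\times\dots\times T(n_k)\to T(n_1+\dots+n_k)$ and a unit $1\in T(1)$, such that $\gamma$ is associative, unital, and equivariant in both variables: $\gamma(w_f;w_1,\dots,w_\ell)=\gamma(w;w_{f1},\dots,w_{fk})_{\bar f}$, where $\bar f$ moves entire blocks according to $f$, and $\gamma(w;(w_1)_{g_1},\dots,(w_k)_{g_k})=\gamma(w;w_1,\dots,w_k)_{g_1+\dots+g_k}$. An *operad* is defined in the same way with bijections in place of all maps. *Categorical theories* and *categorical operads* are the corresponding structures internal to categories (objects and arrows form theories, respectively operads, and source, target, identity and composition are morphisms of such). Every (categorical) theory has an underlying (categorical) operad. For a category $X$, $\mathrm{End}_{Cat}(X)$ is the categorical theory with $\mathrm{End}_{Cat}(X)(n)=\mathrm{Funct}(X^n,X)$. Let $T$ be a theory and let $S(n)\subseteq T(n)$ be sets of words (a *Laplaza set*). Let $G_S$ be the reflexive graph whose objects form the free theory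 on the collection $\{S(n)\}_{n\ge0}$, and whose arrows are the identities together with one arrow $\iota_{a,b}:a\to b$ for any two objects $a,b$ of arity $n$ that project to the same element of $S(n)\subseteq T(n)$, where $\iota_{a,a}=\mathrm{Id}_a$. Let $F_S$ be the free categorical theory on $G_S$ (with the same theory of objects). The categorical theory $T'_S$ is the quotient of $F_S$ by the relations $\iota_{a,b}=\iota_{b,a}^{-1}$ and $\alpha=\beta$ for any two arrows $\alpha,\beta:x\to y$ of $F_S$ such that $x$ and $y$ project to the same element of $S(n)$. A *pseudo $(T,S)$-algebra* structure on $X$ is a morphism of categorical theories $T'_S\to\mathrm{End}_{Cat}(X)$. Let $C$ be an operad. The categorical operad $C'$ has as objects the free operad on the collection $\{C(n)\}_{n\ge0}$, with exactly one arrow between any two objects that project to the same element of $C$ and no other arrows. A *pseudo $C$-algebra* structure on $X$ is a morphism of categorical operads $C'\to\mathrm{End}_{Cat}(X)$. **Proposition.** Let $T$ be a theory which is free on an operad $C$, with unit $\eta:C\to T$, and let $S=\eta(C)$, that is, $S(n)=\eta(C(n))\subseteq T(n)$. There is exactly one morphism of categorical operads $\kappa:C'\to T'_S$ that maps the object of $C'$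 given by each generator $c\in C(n)$ to the object of $T'_S$ given by the generator $\eta(c)\in S(n)$. Moreover: 1. $\kappa$ exhibits $T'_S$ as the free categorical theory on the categorical operad $C'$: for every categorical theory $E$, each morphism of categorical operads $C'\to E$ factors as $\psi\circ\kappa$ for exactly one morphism of categorical theories $\psi:T'_S\to E$. 2. If $T^\sharp_S$ is any free categorical theory on $C'$, with unit $j:C'\to T^\sharp_S$, then there is exactly one morphism of categorical theories $\varphi:T^\sharp_S\to T'_S$ with $\varphi\circ j=\kappa$, and it is an isomorphism. 3. A pseudo $(T,S)$-algebra is the same thing as a pseudo $C$-algebra: for every category $X$, the map $A\mapsto A\circ\kappa$ is a bijection from the pseudo $(T,S)$-algebra structures on $X$ to the pseudo $C$-algebra structures on $X$. -/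

import Mathlib

universe u u' v w

/-- The set `{1, …, n₁ + ⋯ + n_k}` is cut from left to right into blocks of sizes `n₁, …, n_k`;
`blockPos n ⟨i, x⟩` is the `x`-th element of the `i`-th block. -/
def blockPos {k : ℕ} (n : Fin k → ℕ) : (Σ i, Fin (n i)) ≃ Fin (∑ i, n i) :=
  finSigmaFinEquiv

/-- The map `f̄ : n_{f1} + ⋯ + n_{fk} → n₁ + ⋯ + n_l` that moves entire blocks according to `f`. -/
def blockMap {k l : ℕ} (f : Fin k → Fin l) (n : Fin l → ℕ) :
    Fin (∑ i, n (f i)) → Fin (∑ j, n j) :=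
  fun p => blockPos n ⟨f ((blockPos _).symm p).1, ((blockPos _).symm p).2⟩

/-- The map `g₁ + ⋯ + g_k` that places `g₁, …, g_k` side by side. -/
def blockSum {k : ℕ} {n n' : Fin k → ℕ} (g : ∀ i, Fin (n i) → Fin (n' i)) :
    Fin (∑ i, n i) → Fin (∑ i, n' i) :=
  fun p => blockPos n' ⟨((blockPos n).symm p).1, g _ ((blockPos n).symm p).2⟩

theorem blockMap_blockPos {k l : ℕ} (f : Fin k → Fin l) (n : Fin l → ℕ) (i : Fin k)
    (x : Fin (n (f i))) :
    blockMap f n (blockPos (fun i => n (f i)) ⟨i, x⟩) = blockPos n ⟨f i, x⟩ :=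
  congrArg (fun s : Σ i, Fin (n (f i)) => blockPos n ⟨f s.1, s.2⟩) (Equiv.symm_apply_apply _ _)

theorem blockSum_blockPos {k : ℕ} {n n' : Fin k → ℕ} (g : ∀ i, Fin (n i) → Fin (n' i))
    (i : Fin k) (x : Fin (n i)) :
    blockSum g (blockPos n ⟨i, x⟩) = blockPos n' ⟨i, g i x⟩ :=
  congrArg (fun s : Σ i, Fin (n i) => blockPos n' ⟨s.1, g s.1 s.2⟩) (Equiv.symm_apply_apply _ _)

theorem assoc_arity {k : ℕ} (n : Fin k → ℕ) (m : ∀ i, Fin (n i) → ℕ) :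
    ∑ i, ∑ j, m i j = ∑ p, m ((blockPos n).symm p).1 ((blockPos n).symm p).2 := by
  rw [← Fintype.sum_sigma' (fun i j => m i j)]
  exact ((blockPos n).symm.sum_comp (fun s : Σ i, Fin (n i) => m s.1 s.2)).symm

theorem unit_arity (k : ℕ) : k = ∑ _i : Fin k, 1 := by simp

theorem one_arity (k : ℕ) : k = ∑ _i : Fin 1, k := by simp

theorem blockPos_one {k : ℕ} (i : Fin k) (x : Fin 1) :
    blockPos (fun _ : Fin k => 1) ⟨i, x⟩ = Fin.cast (unit_arity k) i := by
  apply Fin.ext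
  simp [blockPos, finSigmaFinEquiv_apply]

theorem one_blockPos {k : ℕ} (i : Fin 1) (x : Fin k) :
    blockPos (fun _ : Fin 1 => k) ⟨i, x⟩ = Fin.cast (one_arity k) x := by
  apply Fin.ext
  have : i = 0 := Subsingleton.elim _ _
  subst this
  simp [blockPos, finSigmaFinEquiv_apply]

theorem blockPos_val {k : ℕ} (n : Fin k → ℕ) (i : Fin k) (x : Fin (n i)) :
    (blockPos n ⟨i, x⟩ : ℕ) = ∑ a : Fin i, n (a.castLE i.2.le) + x :=
  finSigmaFinEquiv_apply _

/-- The two ways of cutting `∑ i, ∑ j, m i j` into blocks agree. -/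
theorem blockPos_assoc {k : ℕ} (n : Fin k → ℕ) (m : ∀ i, Fin (n i) → ℕ) (i : Fin k) (j : Fin (n i))
    (x : Fin (m i j)) :
    Fin.cast (assoc_arity n m) (blockPos (fun i => ∑ j, m i j) ⟨i, blockPos (m i) ⟨j, x⟩⟩) =
      blockPos (fun p => m ((blockPos n).symm p).1 ((blockPos n).symm p).2)
        ⟨blockPos n ⟨i, j⟩, Fin.cast (by rw [Equiv.symm_apply_apply]) x⟩ := by
  let M : ℕ → ℕ := fun p => if h : p < ∑ i, n i then
    m ((blockPos n).symm ⟨p, h⟩).1 ((blockPos n).symm ⟨p, h⟩).2 else 0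
  have hM : ∀ (i : Fin k) (b : Fin (n i)),
      M (∑ a : Fin i, n (a.castLE i.2.le) + b) = m i b := by
    intro i b
    have h := (blockPos n ⟨i, b⟩).2
    have e : (blockPos n).symm ⟨_, h⟩ = ⟨i, b⟩ := (blockPos n).symm_apply_apply _
    rw [← blockPos_val]
    simp only [M, dif_pos h]
    exact congrArg (fun s : Σ i, Fin (n i) => m s.1 s.2) e
  have key : ∀ (i : ℕ) (hi : i ≤ k),
      ∑ p ∈ Finset.range (∑ a : Fin i, n (a.castLE hi)), M p =
        ∑ a : Fin i, ∑ j, m (a.castLE hi) j := by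
    intro i
    induction i with
    | zero => intro hi; simp
    | succ i ih =>
      intro hi
      rw [Fin.sum_univ_castSucc, Fin.sum_univ_castSucc, Finset.sum_range_add]
      exact congrArg₂ (· + ·) (ih (Nat.le_of_succ_le hi))
        ((Finset.sum_range _).trans (Finset.sum_congr rfl fun b _ => hM ⟨i, hi⟩ b))
  apply Fin.ext
  have e : ∑ p : Fin (blockPos n ⟨i, j⟩ : ℕ),
      m ((blockPos n).symm (p.castLE (blockPos n ⟨i, j⟩).2.le)).1
        ((blockPos n).symm (p.castLE (blockPos n ⟨i, j⟩).2.le)).2 =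
      ∑ p ∈ Finset.range (blockPos n ⟨i, j⟩ : ℕ), M p := by
    rw [Finset.sum_range]
    refine Finset.sum_congr rfl fun p _ => ?_
    have h : (p : ℕ) < ∑ i, n i := p.2.trans (blockPos n ⟨i, j⟩).2
    simp only [M, dif_pos h]
    rfl
  rw [Fin.val_cast, blockPos_val, blockPos_val, blockPos_val, Fin.val_cast, e, blockPos_val,
    Finset.sum_range_add, key i i.2.le, Finset.sum_range, add_assoc]
  congr 2
  exact Finset.sum_congr rfl fun b _ => (hM i (b.castLE j.2.le)).symm

/-- The two kinds of systems of operations: theories, acted on by all maps between arities, and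
operads, acted on by bijections only. -/
inductive Kind
  | theory
  | operad

/-- The maps between arities that act on the words of a theory or of an operad. -/
def Kind.Allowed : Kind → ∀ {m n : ℕ}, (Fin m → Fin n) → Prop
  | .theory, _, _, _ => True
  | .operad, _, _, f => Function.Bijective f

namespace Kind

variable {K : Kind}

theorem Allowed.of_bijective {m n : ℕ} {f : Fin m → Fin n} (hf : Function.Bijective f) :
    K.Allowed f := by
  cases K
  · trivial
  · exact hf

theorem Allowed.id (n : ℕ) : K.Allowed (fun x : Fin n => x) :=
  .of_bijective Function.bijective_id

theorem Allowed.cast {m n : ℕ} (h : m = n) : K.Allowed (Fin.cast h) :=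
  .of_bijective (finCongr h).bijective

theorem Allowed.comp {l m n : ℕ} {g : Fin m → Fin n} {f : Fin l → Fin m}
    (hg : K.Allowed g) (hf : K.Allowed f) : K.Allowed (fun x => g (f x)) := by
  cases K
  · trivial
  · exact Function.Bijective.comp hg hf

theorem Allowed.blockMap {k l : ℕ} {f : Fin k → Fin l} (hf : K.Allowed f) (n : Fin l → ℕ) :
    K.Allowed (blockMap f n) := by
  cases K
  · trivial
  · have h : Function.Bijective (Sigma.map (β₂ := fun j => Fin (n j)) f
        (fun i (x : Fin (n (f i))) => x)) :=
      ⟨Function.Injective.sigma_map hf.1 fun _ => Function.injective_id,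
        Function.Surjective.sigma_map hf.2 fun _ => Function.surjective_id⟩
    exact (blockPos n).bijective.comp (h.comp (blockPos _).symm.bijective)

theorem Allowed.blockSum {k : ℕ} {n n' : Fin k → ℕ} {g : ∀ i, Fin (n i) → Fin (n' i)}
    (hg : ∀ i, K.Allowed (g i)) : K.Allowed (blockSum g) := by
  cases K
  · trivial
  · have h : Function.Bijective (Sigma.map (β₂ := fun j => Fin (n' j)) (fun i => i) g) :=
      ⟨Function.Injective.sigma_map Function.injective_id fun i => (hg i).1,
        Function.Surjective.sigma_map Function.surjective_id fun i => (hg i).2⟩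
    exact (blockPos n').bijective.comp (h.comp (blockPos n).symm.bijective)

end Kind

/-- A theory (if `K = theory`) or an operad (if `K = operad`): sets of words of each arity with
a functorial action `w ↦ w_f` (`map`) of all maps (respectively all bijections) between arities,
compositions `γ` (`comp`) and a unit, such that `γ` is associative, unital, and equivariant in both
variables. Words whose arities are equal, but not syntactically, are compared through the action of
`Fin.cast`, which is the identity on the underlying numbers. -/
structure OpSystem (K : Kind) where
  word : ℕ → Type u
  map : ∀ {m n : ℕ} (f : Fin m → Fin n), K.Allowed f → word m → word n
  one : word 1
  comp : ∀ {k : ℕ} {n : Fin k → ℕ}, word k → (∀ i, word (n i)) → word (∑ i, n i)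
  map_id : ∀ {n : ℕ} (w : word n), map (fun x => x) (.id n) w = w
  map_map : ∀ {l m n : ℕ} (g : Fin m → Fin n) (hg : K.Allowed g) (f : Fin l → Fin m)
    (hf : K.Allowed f) (w : word l),
    map g hg (map f hf w) = map (fun x => g (f x)) (hg.comp hf) w
  comp_assoc : ∀ {k : ℕ} {n : Fin k → ℕ} {m : ∀ i, Fin (n i) → ℕ} (w : word k)
    (ws : ∀ i, word (n i)) (us : ∀ i j, word (m i j)),
    map (Fin.cast (assoc_arity n m)) (.cast _) (comp w fun i => comp (ws i) (us i)) =
      comp (comp w ws) fun p => us ((blockPos n).symm p).1 ((blockPos n).symm p).2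
  comp_one : ∀ {k : ℕ} (w : word k),
    comp w (fun _ => one) = map (Fin.cast (unit_arity k)) (.cast _) w
  one_comp : ∀ {k : ℕ} (w : word k),
    comp one (fun _ => w) = map (Fin.cast (one_arity k)) (.cast _) w
  map_comp : ∀ {k l : ℕ} {n : Fin l → ℕ} (f : Fin k → Fin l) (hf : K.Allowed f) (w : word k)
    (ws : ∀ j, word (n j)),
    comp (map f hf w) ws = map (blockMap f n) (hf.blockMap n) (comp w fun i => ws (f i))
  comp_map : ∀ {k : ℕ} {n n' : Fin k → ℕ} (g : ∀ i, Fin (n i) → Fin (n' i))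
    (hg : ∀ i, K.Allowed (g i)) (w : word k) (ws : ∀ i, word (n i)),
    comp w (fun i => map (g i) (hg i) (ws i)) =
      map (blockSum g) (Kind.Allowed.blockSum hg) (comp w ws)

/-- Theories. -/
abbrev Theory := OpSystem.{u} Kind.theory

/-- Operads. -/
abbrev Operad := OpSystem.{u} Kind.operad

namespace OpSystem

variable {K : Kind}

/-- Morphisms of theories, respectively of operads. -/
@[ext]
structure Hom (A : OpSystem.{u} K) (B : OpSystem.{v} K) where
  app : ∀ {n : ℕ}, A.word n → B.word n
  app_map : ∀ {m n : ℕ} (f : Fin m → Fin n) (hf : K.Allowed f) (w : A.word m),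
    app (A.map f hf w) = B.map f hf (app w)
  app_one : app A.one = B.one
  app_comp : ∀ {k : ℕ} {n : Fin k → ℕ} (w : A.word k) (ws : ∀ i, A.word (n i)),
    app (A.comp w ws) = B.comp (app w) fun i => app (ws i)

/-- The identity morphism. -/
def Hom.id (A : OpSystem.{u} K) : Hom A A where
  app a := a
  app_map _ _ _ := rfl
  app_one := rfl
  app_comp _ _ := rfl

/-- The composite `ψ ∘ φ`. -/
def Hom.comp {A : OpSystem.{u} K} {B : OpSystem.{v} K} {D : OpSystem.{w} K}
    (ψ : Hom B D) (φ : Hom A B) : Hom A D where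
  app a := ψ.app (φ.app a)
  app_map f hf w := by rw [φ.app_map, ψ.app_map]
  app_one := by rw [φ.app_one, ψ.app_one]
  app_comp w ws := by rw [φ.app_comp, ψ.app_comp]

end OpSystem

theorem Kind.Allowed.theory {m n : ℕ} (f : Fin m → Fin n) : Kind.theory.Allowed f := trivial

/-- The underlying operad of a theory. -/
def OpSystem.toOperad (T : Theory.{u}) : Operad.{u} where
  word := T.word
  map f _ w := T.map f (.theory f) w
  one := T.one
  comp := T.comp
  map_id := T.map_id
  map_map g _ f _ := T.map_map g _ f _
  comp_assoc := T.comp_assoc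
  comp_one := T.comp_one
  one_comp := T.one_comp
  map_comp f _ := T.map_comp f _
  comp_map g _ := T.comp_map g _

/-- A morphism of theories as a morphism of the underlying operads. -/
def OpSystem.Hom.toOperad {T : Theory.{u}} {T' : Theory.{v}} (φ : OpSystem.Hom T T') :
    OpSystem.Hom T.toOperad T'.toOperad where
  app := φ.app
  app_map f _ := φ.app_map f _
  app_one := φ.app_one
  app_comp := φ.app_comp

/-- `T` is the free theory on the operad `C`, with unit `η`: every morphism of operads from `C` to
a theory extends uniquely along `η` to a morphism of theories. -/
def IsFreeTheoryOn {C : Operad.{u}} {T : Theory.{u}} (η : OpSystem.Hom C T.toOperad) : Prop :=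
  ∀ (E : Theory.{u}) (φ : OpSystem.Hom C E.toOperad),
    ∃! ψ : OpSystem.Hom T E, ψ.toOperad.comp η = φ

/-- Formal expressions in the operations of a theory (or operad) and the elements of `Z`. -/
inductive FreeTerm (K : Kind) (Z : ℕ → Type u) : ℕ → Type u
  | gen {n : ℕ} (z : Z n) : FreeTerm K Z n
  | one : FreeTerm K Z 1
  | map {m n : ℕ} (f : Fin m → Fin n) (hf : K.Allowed f) (t : FreeTerm K Z m) : FreeTerm K Z n
  | comp {k : ℕ} {n : Fin k → ℕ} (t : FreeTerm K Z k) (ts : ∀ i, FreeTerm K Z (n i)) :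
      FreeTerm K Z (∑ i, n i)

/-- The smallest equivalence relation on formal expressions that is preserved by the operations
and contains all instances of the axioms of a theory (or operad). -/
inductive FreeTerm.Rel {K : Kind} {Z : ℕ → Type u} :
    ∀ {n : ℕ}, FreeTerm K Z n → FreeTerm K Z n → Prop
  | refl {n : ℕ} (t : FreeTerm K Z n) : Rel t t
  | symm {n : ℕ} {t t' : FreeTerm K Z n} : Rel t t' → Rel t' t
  | trans {n : ℕ} {t t' t'' : FreeTerm K Z n} : Rel t t' → Rel t' t'' → Rel t t''
  | map {m n : ℕ} (f : Fin m → Fin n) (hf : K.Allowed f) {t t' : FreeTerm K Z m} :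
      Rel t t' → Rel (t.map f hf) (t'.map f hf)
  | comp {k : ℕ} {n : Fin k → ℕ} {t t' : FreeTerm K Z k} {ts ts' : ∀ i, FreeTerm K Z (n i)} :
      Rel t t' → (∀ i, Rel (ts i) (ts' i)) → Rel (t.comp ts) (t'.comp ts')
  | map_id {n : ℕ} (t : FreeTerm K Z n) : Rel (t.map (fun x => x) (.id n)) t
  | map_map {l m n : ℕ} (g : Fin m → Fin n) (hg : K.Allowed g) (f : Fin l → Fin m)
      (hf : K.Allowed f) (t : FreeTerm K Z l) :
      Rel ((t.map f hf).map g hg) (t.map (fun x => g (f x)) (hg.comp hf))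
  | comp_assoc {k : ℕ} {n : Fin k → ℕ} {m : ∀ i, Fin (n i) → ℕ} (t : FreeTerm K Z k)
      (ts : ∀ i, FreeTerm K Z (n i)) (us : ∀ i j, FreeTerm K Z (m i j)) :
      Rel ((t.comp fun i => (ts i).comp (us i)).map (Fin.cast (assoc_arity n m)) (.cast _))
        ((t.comp ts).comp fun p => us ((blockPos n).symm p).1 ((blockPos n).symm p).2)
  | comp_one {k : ℕ} (t : FreeTerm K Z k) :
      Rel (t.comp fun _ => .one) (t.map (Fin.cast (unit_arity k)) (.cast _))
  | one_comp {k : ℕ} (t : FreeTerm K Z k) :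
      Rel (FreeTerm.one.comp fun _ => t) (t.map (Fin.cast (one_arity k)) (.cast _))
  | map_comp {k l : ℕ} {n : Fin l → ℕ} (f : Fin k → Fin l) (hf : K.Allowed f)
      (t : FreeTerm K Z k) (ts : ∀ j, FreeTerm K Z (n j)) :
      Rel ((t.map f hf).comp ts) ((t.comp fun i => ts (f i)).map (blockMap f n) (hf.blockMap n))
  | comp_map {k : ℕ} {n n' : Fin k → ℕ} (g : ∀ i, Fin (n i) → Fin (n' i))
      (hg : ∀ i, K.Allowed (g i)) (t : FreeTerm K Z k) (ts : ∀ i, FreeTerm K Z (n i)) :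
      Rel (t.comp fun i => (ts i).map (g i) (hg i))
        ((t.comp ts).map (blockSum g) (Kind.Allowed.blockSum hg))

instance FreeTerm.setoid (K : Kind) (Z : ℕ → Type u) (n : ℕ) : Setoid (FreeTerm K Z n) where
  r := FreeTerm.Rel
  iseqv := ⟨.refl, .symm, .trans⟩

namespace OpSystem

variable {K : Kind} {Z : ℕ → Type u}

theorem out_rel {n : ℕ} (t : FreeTerm K Z n) :
    FreeTerm.Rel (Quotient.mk (FreeTerm.setoid K Z n) t).out t :=
  Quotient.exact (s := FreeTerm.setoid K Z n) (Quotient.out_eq _)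

/-- The free theory (or operad) on a collection `Z`: formal expressions modulo the axioms. -/
noncomputable def free (K : Kind) (Z : ℕ → Type u) : OpSystem.{u} K where
  word n := Quotient (FreeTerm.setoid K Z n)
  map f hf := Quotient.map (FreeTerm.map f hf) fun _ _ h => .map f hf h
  one := ⟦.one⟧
  comp w ws := ⟦w.out.comp fun i => (ws i).out⟧
  map_id w := by
    induction w using Quotient.inductionOn
    exact Quotient.sound (.map_id _)
  map_map g hg f hf w := by
    induction w using Quotient.inductionOn
    exact Quotient.sound (.map_map g hg f hf _)
  comp_assoc {k n m} w ws us := Quotient.sound <|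
    (FreeTerm.Rel.map _ _ (.comp (.refl _) fun _ => out_rel _)).trans <|
      (FreeTerm.Rel.comp_assoc w.out (fun i => (ws i).out) fun i j => (us i j).out).trans <|
        .comp (out_rel _).symm fun _ => .refl _
  comp_one w := by
    induction w using Quotient.inductionOn with | _ t => ?_
    exact Quotient.sound <| (FreeTerm.Rel.comp (out_rel t) fun _ => out_rel .one).trans
      (.comp_one t)
  one_comp w := by
    induction w using Quotient.inductionOn with | _ t => ?_
    exact Quotient.sound <| (FreeTerm.Rel.comp (out_rel .one) fun _ => out_rel t).trans
      (.one_comp t)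
  map_comp f hf w ws := by
    induction w using Quotient.inductionOn with | _ t => ?_
    exact Quotient.sound <| (FreeTerm.Rel.comp (out_rel (t.map f hf)) fun _ => .refl _).trans <|
      (FreeTerm.Rel.map_comp f hf t _).trans <|
        .map _ _ (.comp (out_rel t).symm fun _ => .refl _)
  comp_map {_ n n'} g hg w ws := by
    have h : ∀ i, (ws i).out.map (g i) (hg i) ≈ (Quotient.map (sb := FreeTerm.setoid K Z (n' i))
        (FreeTerm.map (g i) (hg i)) (fun _ _ h => .map _ _ h) (ws i)).out := by
      intro i
      refine Quotient.exact ?_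
      rw [Quotient.out_eq]
      conv_rhs => rw [← Quotient.out_eq (ws i)]
      rfl
    exact Quotient.sound <| (FreeTerm.Rel.comp (.refl _) fun i => (h i).symm).trans
      (.comp_map g hg w.out fun i => (ws i).out)

/-- The value of a formal expression, given values of the generators. -/
def FreeTerm.eval {A : OpSystem.{v} K} (φ : ∀ n, Z n → A.word n) :
    ∀ {n : ℕ}, FreeTerm K Z n → A.word n
  | _, .gen z => φ _ z
  | _, .one => A.one
  | _, .map f hf t => A.map f hf (eval φ t)
  | _, .comp t ts => A.comp (eval φ t) fun i => eval φ (ts i)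

theorem FreeTerm.eval_rel {A : OpSystem.{v} K} (φ : ∀ n, Z n → A.word n) {n : ℕ}
    {t t' : FreeTerm K Z n} (h : t.Rel t') : eval φ t = eval φ t' := by
  induction h with
  | refl => rfl
  | symm _ ih => exact ih.symm
  | trans _ _ ih ih' => exact ih.trans ih'
  | map f hf _ ih => exact congrArg (A.map f hf) ih
  | comp _ _ ih ih' => exact congrArg₂ A.comp ih (funext ih')
  | map_id => exact A.map_id _
  | map_map => exact A.map_map ..
  | comp_assoc => exact A.comp_assoc ..
  | comp_one => exact A.comp_one _
  | one_comp => exact A.one_comp _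
  | map_comp => exact A.map_comp ..
  | comp_map => exact A.comp_map ..

/-- The generator given by an element of the collection. -/
def free.gen {n : ℕ} (z : Z n) : (free K Z).word n := Quotient.mk (FreeTerm.setoid K Z n) (.gen z)

/-- The morphism from the free theory (or operad) that extends a map on the generators. -/
def free.lift {A : OpSystem.{v} K} (φ : ∀ n, Z n → A.word n) : Hom (free K Z) A where
  app := Quotient.lift (FreeTerm.eval φ) fun _ _ h => FreeTerm.eval_rel φ h
  app_map f hf w := Quotient.inductionOn w fun _ => rfl
  app_one := rfl
  app_comp w ws := by
    have h : ∀ {n : ℕ} (w : Quotient (FreeTerm.setoid K Z n)), FreeTerm.eval φ w.out =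
        Quotient.lift (FreeTerm.eval φ) (fun _ _ h => FreeTerm.eval_rel φ h) w := by
      intro n w
      conv_rhs => rw [← Quotient.out_eq w]
      rfl
    exact congrArg₂ A.comp (h w) (funext fun i => h (ws i))

end OpSystem

/-- A categorical theory (or categorical operad), that is, a theory (or operad) internal to
categories: an object theory `Ob` and a morphism theory `Mor`, with source, target, identity
(`idm`) and composition of arrows (`vcomp`, in diagrammatic order), which are morphisms of theories
and satisfy the laws of a category. -/
structure CatSystem (K : Kind) where
  Ob : OpSystem.{u} K
  Mor : OpSystem.{u} K
  src : OpSystem.Hom Mor Ob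
  tgt : OpSystem.Hom Mor Ob
  idm : OpSystem.Hom Ob Mor
  vcomp : ∀ {n : ℕ} (p q : Mor.word n), tgt.app p = src.app q → Mor.word n
  src_idm : ∀ {n : ℕ} (a : Ob.word n), src.app (idm.app a) = a
  tgt_idm : ∀ {n : ℕ} (a : Ob.word n), tgt.app (idm.app a) = a
  src_vcomp : ∀ {n : ℕ} (p q : Mor.word n) (h), src.app (vcomp p q h) = src.app p
  tgt_vcomp : ∀ {n : ℕ} (p q : Mor.word n) (h), tgt.app (vcomp p q h) = tgt.app q
  id_vcomp : ∀ {n : ℕ} (p : Mor.word n) (h), vcomp (idm.app (src.app p)) p h = p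
  vcomp_id : ∀ {n : ℕ} (p : Mor.word n) (h), vcomp p (idm.app (tgt.app p)) h = p
  vcomp_assoc : ∀ {n : ℕ} (p q r : Mor.word n) (h h' h₁ h₂),
    vcomp (vcomp p q h) r h₁ = vcomp p (vcomp q r h') h₂
  vcomp_map : ∀ {m n : ℕ} (f : Fin m → Fin n) (hf : K.Allowed f) (p q : Mor.word m) (h h'),
    vcomp (Mor.map f hf p) (Mor.map f hf q) h' = Mor.map f hf (vcomp p q h)
  vcomp_one : ∀ h, vcomp Mor.one Mor.one h = Mor.one
  vcomp_comp : ∀ {k : ℕ} {n : Fin k → ℕ} (p q : Mor.word k) (ps qs : ∀ i, Mor.word (n i))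
    (h : tgt.app p = src.app q) (hs : ∀ i, tgt.app (ps i) = src.app (qs i)) (h'),
    vcomp (Mor.comp p ps) (Mor.comp q qs) h' =
      Mor.comp (vcomp p q h) fun i => vcomp (ps i) (qs i) (hs i)

/-- Categorical theories. -/
abbrev CatTheory := CatSystem.{u} Kind.theory

/-- Categorical operads. -/
abbrev CatOperad := CatSystem.{u} Kind.operad

namespace CatSystem

variable {K : Kind}

/-- Morphisms of categorical theories, respectively of categorical operads. -/
@[ext]
structure Hom (A : CatSystem.{u} K) (B : CatSystem.{v} K) where
  ob : OpSystem.Hom A.Ob B.Ob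
  mor : OpSystem.Hom A.Mor B.Mor
  src_mor : ∀ {n : ℕ} (p : A.Mor.word n), B.src.app (mor.app p) = ob.app (A.src.app p)
  tgt_mor : ∀ {n : ℕ} (p : A.Mor.word n), B.tgt.app (mor.app p) = ob.app (A.tgt.app p)
  mor_idm : ∀ {n : ℕ} (a : A.Ob.word n), mor.app (A.idm.app a) = B.idm.app (ob.app a)
  mor_vcomp : ∀ {n : ℕ} (p q : A.Mor.word n) (h h'),
    mor.app (A.vcomp p q h) = B.vcomp (mor.app p) (mor.app q) h'

/-- The identity morphism. -/
def Hom.id (A : CatSystem.{u} K) : Hom A A where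
  ob := .id _
  mor := .id _
  src_mor _ := rfl
  tgt_mor _ := rfl
  mor_idm _ := rfl
  mor_vcomp _ _ _ _ := rfl

/-- The composite `ψ ∘ φ`. -/
def Hom.comp {A : CatSystem.{u} K} {B : CatSystem.{v} K} {D : CatSystem.{w} K}
    (ψ : Hom B D) (φ : Hom A B) : Hom A D where
  ob := ψ.ob.comp φ.ob
  mor := ψ.mor.comp φ.mor
  src_mor p := (ψ.src_mor _).trans (congrArg ψ.ob.app (φ.src_mor p))
  tgt_mor p := (ψ.tgt_mor _).trans (congrArg ψ.ob.app (φ.tgt_mor p))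
  mor_idm a := (congrArg ψ.mor.app (φ.mor_idm a)).trans (ψ.mor_idm _)
  mor_vcomp p q h h' := by
    have h₁ : B.tgt.app (φ.mor.app p) = B.src.app (φ.mor.app q) := by
      rw [φ.tgt_mor, φ.src_mor, h]
    exact (congrArg ψ.mor.app (φ.mor_vcomp p q h h₁)).trans (ψ.mor_vcomp _ _ h₁ h')

/-- Isomorphisms. -/
def Hom.IsIso {A : CatSystem.{u} K} {B : CatSystem.{v} K} (φ : Hom A B) : Prop :=
  ∃ ψ : Hom B A, ψ.comp φ = Hom.id A ∧ φ.comp ψ = Hom.id B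

/-- The underlying categorical operad of a categorical theory. -/
def toOperad (T : CatTheory.{u}) : CatOperad.{u} where
  Ob := T.Ob.toOperad
  Mor := T.Mor.toOperad
  src := T.src.toOperad
  tgt := T.tgt.toOperad
  idm := T.idm.toOperad
  vcomp := T.vcomp
  src_idm := T.src_idm
  tgt_idm := T.tgt_idm
  src_vcomp := T.src_vcomp
  tgt_vcomp := T.tgt_vcomp
  id_vcomp := T.id_vcomp
  vcomp_id := T.vcomp_id
  vcomp_assoc := T.vcomp_assoc
  vcomp_map f _ := T.vcomp_map f _
  vcomp_one := T.vcomp_one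
  vcomp_comp := T.vcomp_comp

/-- A morphism of categorical theories as a morphism of the underlying categorical operads. -/
def Hom.toOperad {T : CatTheory.{u}} {T' : CatTheory.{v}} (φ : Hom T T') :
    Hom T.toOperad T'.toOperad where
  ob := φ.ob.toOperad
  mor := φ.mor.toOperad
  src_mor := φ.src_mor
  tgt_mor := φ.tgt_mor
  mor_idm := φ.mor_idm
  mor_vcomp := φ.mor_vcomp

end CatSystem

/-- `T` is the free categorical theory on the categorical operad `C`, with unit `j`, as tested by
the categorical theories in a given universe. -/
def IsFreeCatTheoryOn {C : CatOperad.{u}} {T : CatTheory.{v}}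
    (j : CatSystem.Hom C T.toOperad) : Prop :=
  ∀ (E : CatTheory.{w}) (φ : CatSystem.Hom C E.toOperad),
    ∃! ψ : CatSystem.Hom T E, ψ.toOperad.comp j = φ

/-- An object theory (or operad) together with sets of arrows, and operations on arrows as in a
categorical theory (or operad) that are compatible with sources and targets, but without any laws
on arrows. -/
structure PreCatSystem (K : Kind) where
  Ob : OpSystem.{u} K
  Mor : ℕ → Type u
  src : ∀ {n : ℕ}, Mor n → Ob.word n
  tgt : ∀ {n : ℕ}, Mor n → Ob.word n
  idm : ∀ {n : ℕ}, Ob.word n → Mor n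
  vcomp : ∀ {n : ℕ} (p q : Mor n), tgt p = src q → Mor n
  map : ∀ {m n : ℕ} (f : Fin m → Fin n), K.Allowed f → Mor m → Mor n
  comp : ∀ {k : ℕ} {n : Fin k → ℕ}, Mor k → (∀ i, Mor (n i)) → Mor (∑ i, n i)
  src_idm : ∀ {n : ℕ} (a : Ob.word n), src (idm a) = a
  tgt_idm : ∀ {n : ℕ} (a : Ob.word n), tgt (idm a) = a
  src_vcomp : ∀ {n : ℕ} (p q : Mor n) (h), src (vcomp p q h) = src p
  tgt_vcomp : ∀ {n : ℕ} (p q : Mor n) (h), tgt (vcomp p q h) = tgt q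
  src_map : ∀ {m n : ℕ} (f : Fin m → Fin n) (hf : K.Allowed f) (p : Mor m),
    src (map f hf p) = Ob.map f hf (src p)
  tgt_map : ∀ {m n : ℕ} (f : Fin m → Fin n) (hf : K.Allowed f) (p : Mor m),
    tgt (map f hf p) = Ob.map f hf (tgt p)
  src_comp : ∀ {k : ℕ} {n : Fin k → ℕ} (p : Mor k) (ps : ∀ i, Mor (n i)),
    src (comp p ps) = Ob.comp (src p) fun i => src (ps i)
  tgt_comp : ∀ {k : ℕ} {n : Fin k → ℕ} (p : Mor k) (ps : ∀ i, Mor (n i)),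
    tgt (comp p ps) = Ob.comp (tgt p) fun i => tgt (ps i)

namespace PreCatSystem

variable {K : Kind}

/-- The smallest equivalence relation on arrows that is preserved by all the operations, contains
all instances of the axioms of a categorical theory (or operad), and identifies any two parallel
arrows related by `R`. -/
inductive Rel (A : PreCatSystem.{u} K) (R : ∀ n, A.Mor n → A.Mor n → Prop) :
    ∀ {n : ℕ}, A.Mor n → A.Mor n → Prop
  | of {n : ℕ} {p q : A.Mor n} : R n p q → A.src p = A.src q → A.tgt p = A.tgt q → Rel A R p q
  | refl {n : ℕ} (p : A.Mor n) : Rel A R p p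
  | symm {n : ℕ} {p q : A.Mor n} : Rel A R p q → Rel A R q p
  | trans {n : ℕ} {p q r : A.Mor n} : Rel A R p q → Rel A R q r → Rel A R p r
  | vcomp {n : ℕ} {p p' q q' : A.Mor n} (h h') :
      Rel A R p p' → Rel A R q q' → Rel A R (A.vcomp p q h) (A.vcomp p' q' h')
  | map {m n : ℕ} (f : Fin m → Fin n) (hf : K.Allowed f) {p q : A.Mor m} :
      Rel A R p q → Rel A R (A.map f hf p) (A.map f hf q)
  | comp {k : ℕ} {n : Fin k → ℕ} {p q : A.Mor k} {ps qs : ∀ i, A.Mor (n i)} :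
      Rel A R p q → (∀ i, Rel A R (ps i) (qs i)) → Rel A R (A.comp p ps) (A.comp q qs)
  -- the laws of a category
  | id_vcomp {n : ℕ} (p : A.Mor n) (h) : Rel A R (A.vcomp (A.idm (A.src p)) p h) p
  | vcomp_id {n : ℕ} (p : A.Mor n) (h) : Rel A R (A.vcomp p (A.idm (A.tgt p)) h) p
  | vcomp_assoc {n : ℕ} (p q r : A.Mor n) (h h' h₁ h₂) :
      Rel A R (A.vcomp (A.vcomp p q h) r h₁) (A.vcomp p (A.vcomp q r h') h₂)
  -- identities and composition of arrows are compatible with the operations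
  | idm_map {m n : ℕ} (f : Fin m → Fin n) (hf : K.Allowed f) (a : A.Ob.word m) :
      Rel A R (A.idm (A.Ob.map f hf a)) (A.map f hf (A.idm a))
  | idm_comp {k : ℕ} {n : Fin k → ℕ} (a : A.Ob.word k) (as : ∀ i, A.Ob.word (n i)) :
      Rel A R (A.idm (A.Ob.comp a as)) (A.comp (A.idm a) fun i => A.idm (as i))
  | vcomp_map {m n : ℕ} (f : Fin m → Fin n) (hf : K.Allowed f) (p q : A.Mor m) (h h') :
      Rel A R (A.vcomp (A.map f hf p) (A.map f hf q) h') (A.map f hf (A.vcomp p q h))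
  | vcomp_comp {k : ℕ} {n : Fin k → ℕ} (p q : A.Mor k) (ps qs : ∀ i, A.Mor (n i)) (h)
      (hs : ∀ i, A.tgt (ps i) = A.src (qs i)) (h') :
      Rel A R (A.vcomp (A.comp p ps) (A.comp q qs) h')
        (A.comp (A.vcomp p q h) fun i => A.vcomp (ps i) (qs i) (hs i))
  -- the laws of a theory (or operad) on morphisms, with the identity of the unit as unit
  | map_id {n : ℕ} (p : A.Mor n) : Rel A R (A.map (fun x => x) (.id n) p) p
  | map_map {l m n : ℕ} (g : Fin m → Fin n) (hg : K.Allowed g) (f : Fin l → Fin m)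
      (hf : K.Allowed f) (p : A.Mor l) :
      Rel A R (A.map g hg (A.map f hf p)) (A.map (fun x => g (f x)) (hg.comp hf) p)
  | comp_assoc {k : ℕ} {n : Fin k → ℕ} {m : ∀ i, Fin (n i) → ℕ} (p : A.Mor k)
      (ps : ∀ i, A.Mor (n i)) (qs : ∀ i j, A.Mor (m i j)) :
      Rel A R
        (A.map (Fin.cast (assoc_arity n m)) (.cast _) (A.comp p fun i => A.comp (ps i) (qs i)))
        (A.comp (A.comp p ps) fun x => qs ((blockPos n).symm x).1 ((blockPos n).symm x).2)
  | comp_one {k : ℕ} (p : A.Mor k) :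
      Rel A R (A.comp p fun _ => A.idm A.Ob.one) (A.map (Fin.cast (unit_arity k)) (.cast _) p)
  | one_comp {k : ℕ} (p : A.Mor k) :
      Rel A R (A.comp (A.idm A.Ob.one) fun _ => p) (A.map (Fin.cast (one_arity k)) (.cast _) p)
  | map_comp {k l : ℕ} {n : Fin l → ℕ} (f : Fin k → Fin l) (hf : K.Allowed f) (p : A.Mor k)
      (ps : ∀ j, A.Mor (n j)) :
      Rel A R (A.comp (A.map f hf p) ps)
        (A.map (blockMap f n) (hf.blockMap n) (A.comp p fun i => ps (f i)))
  | comp_map {k : ℕ} {n n' : Fin k → ℕ} (g : ∀ i, Fin (n i) → Fin (n' i))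
      (hg : ∀ i, K.Allowed (g i)) (p : A.Mor k) (ps : ∀ i, A.Mor (n i)) :
      Rel A R (A.comp p fun i => A.map (g i) (hg i) (ps i))
        (A.map (blockSum g) (Kind.Allowed.blockSum hg) (A.comp p ps))

variable {A : PreCatSystem.{u} K} {R : ∀ n, A.Mor n → A.Mor n → Prop}

theorem Rel.endpoints {n : ℕ} {p q : A.Mor n} (h : Rel A R p q) :
    A.src p = A.src q ∧ A.tgt p = A.tgt q := by
  induction h with
  | of _ h h' => exact ⟨h, h'⟩
  | refl => exact ⟨rfl, rfl⟩
  | symm _ ih => exact ⟨ih.1.symm, ih.2.symm⟩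
  | trans _ _ ih ih' => exact ⟨ih.1.trans ih'.1, ih.2.trans ih'.2⟩
  | vcomp _ _ _ _ ih ih' => simp only [src_vcomp, tgt_vcomp, ih.1, ih'.2, and_self]
  | map _ _ _ ih => simp only [src_map, tgt_map, ih.1, ih.2, and_self]
  | comp _ _ ih ih' =>
    simp only [src_comp, tgt_comp, ih.1, ih.2, fun i => (ih' i).1, fun i => (ih' i).2, and_self]
  | id_vcomp => simp only [src_vcomp, tgt_vcomp, src_idm, and_self]
  | vcomp_id => simp only [src_vcomp, tgt_vcomp, tgt_idm, and_self]
  | vcomp_assoc => simp only [src_vcomp, tgt_vcomp, and_self]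
  | idm_map => simp only [src_map, tgt_map, src_idm, tgt_idm, and_self]
  | idm_comp => simp only [src_comp, tgt_comp, src_idm, tgt_idm, and_self]
  | vcomp_map => simp only [src_vcomp, tgt_vcomp, src_map, tgt_map, and_self]
  | vcomp_comp => simp only [src_vcomp, tgt_vcomp, src_comp, tgt_comp, and_self]
  | map_id => simp only [src_map, tgt_map, OpSystem.map_id, and_self]
  | map_map => simp only [src_map, tgt_map, OpSystem.map_map, and_self]
  | comp_assoc => simp only [src_map, tgt_map, src_comp, tgt_comp, OpSystem.comp_assoc, and_self]
  | comp_one =>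
    simp only [src_map, tgt_map, src_comp, tgt_comp, src_idm, tgt_idm, OpSystem.comp_one, and_self]
  | one_comp =>
    simp only [src_map, tgt_map, src_comp, tgt_comp, src_idm, tgt_idm, OpSystem.one_comp, and_self]
  | map_comp => simp only [src_map, tgt_map, src_comp, tgt_comp, OpSystem.map_comp, and_self]
  | comp_map => simp only [src_map, tgt_map, src_comp, tgt_comp, OpSystem.comp_map, and_self]

/-- `Rel` as a setoid. -/
def setoid (A : PreCatSystem.{u} K) (R : ∀ n, A.Mor n → A.Mor n → Prop) (n : ℕ) :
    Setoid (A.Mor n) where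
  r := Rel A R
  iseqv := ⟨.refl, .symm, .trans⟩

/-- The class of an arrow. -/
def cls (A : PreCatSystem.{u} K) (R : ∀ n, A.Mor n → A.Mor n → Prop) {n : ℕ} (p : A.Mor n) :
    Quotient (A.setoid R n) :=
  Quotient.mk _ p

theorem cls_eq {n : ℕ} {p q : A.Mor n} (h : Rel A R p q) : A.cls R p = A.cls R q :=
  Quotient.sound h

theorem cls_out {n : ℕ} (p : Quotient (A.setoid R n)) : A.cls R p.out = p :=
  Quotient.out_eq p

theorem out_cls {n : ℕ} (p : A.Mor n) : Rel A R (A.cls R p).out p :=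
  Quotient.exact (s := A.setoid R n) (Quotient.out_eq _)

/-- The theory (or operad) of classes of arrows. -/
noncomputable def quotMor (A : PreCatSystem.{u} K) (R : ∀ n, A.Mor n → A.Mor n → Prop) :
    OpSystem.{u} K where
  word n := Quotient (A.setoid R n)
  map f hf p := A.cls R (A.map f hf p.out)
  one := A.cls R (A.idm A.Ob.one)
  comp p ps := A.cls R (A.comp p.out fun i => (ps i).out)
  map_id p := (cls_eq (.map_id _)).trans (cls_out p)
  map_map g hg f hf _ := cls_eq <| (Rel.map g hg (out_cls _)).trans (.map_map g hg f hf _)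
  comp_assoc p ps qs := cls_eq <|
    (Rel.map _ _ ((out_cls _).trans (.comp (.refl _) fun _ => out_cls _))).trans <|
      (Rel.comp_assoc p.out (fun i => (ps i).out) fun i j => (qs i j).out).trans <|
        .comp (out_cls _).symm fun _ => .refl _
  comp_one _ := cls_eq <| (Rel.comp (.refl _) fun _ => out_cls _).trans (.comp_one _)
  one_comp _ := cls_eq <| (Rel.comp (out_cls _) fun _ => .refl _).trans (.one_comp _)
  map_comp f hf p ps := cls_eq <| (Rel.comp (out_cls _) fun _ => .refl _).trans <|
    (Rel.map_comp f hf p.out fun j => (ps j).out).trans (.map _ _ (out_cls _).symm)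
  comp_map g hg p ps := cls_eq <| (Rel.comp (.refl _) fun _ => out_cls _).trans <|
    (Rel.comp_map g hg p.out fun j => (ps j).out).trans (.map _ _ (out_cls _).symm)

theorem src_out {n : ℕ} (p : A.Mor n) : A.src (A.cls R p).out = A.src p :=
  (out_cls p).endpoints.1

theorem tgt_out {n : ℕ} (p : A.Mor n) : A.tgt (A.cls R p).out = A.tgt p :=
  (out_cls p).endpoints.2

/-- The quotient by `Rel`: a categorical theory (or operad) with the same objects. -/
noncomputable def quot (A : PreCatSystem.{u} K) (R : ∀ n, A.Mor n → A.Mor n → Prop) :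
    CatSystem.{u} K where
  Ob := A.Ob
  Mor := A.quotMor R
  src :=
    { app := fun p => A.src p.out
      app_map := fun f hf _ => (src_out _).trans (A.src_map f hf _)
      app_one := (src_out _).trans (A.src_idm _)
      app_comp := fun _ _ => (src_out _).trans (A.src_comp _ _) }
  tgt :=
    { app := fun p => A.tgt p.out
      app_map := fun f hf _ => (tgt_out _).trans (A.tgt_map f hf _)
      app_one := (tgt_out _).trans (A.tgt_idm _)
      app_comp := fun _ _ => (tgt_out _).trans (A.tgt_comp _ _) }
  idm :=
    { app := fun a => A.cls R (A.idm a)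
      app_map := fun f hf a => cls_eq <| (Rel.idm_map f hf a).trans (.map f hf (out_cls _).symm)
      app_one := rfl
      app_comp := fun a as => cls_eq <| (Rel.idm_comp a as).trans
        (.comp (out_cls _).symm fun _ => (out_cls _).symm) }
  vcomp p q h := A.cls R (A.vcomp p.out q.out h)
  src_idm a := (src_out _).trans (A.src_idm a)
  tgt_idm a := (tgt_out _).trans (A.tgt_idm a)
  src_vcomp p q h := (src_out _).trans (A.src_vcomp _ _ _)
  tgt_vcomp p q h := (tgt_out _).trans (A.tgt_vcomp _ _ _)
  id_vcomp p _ := (cls_eq <| (Rel.vcomp _ (A.tgt_idm _) (out_cls _) (.refl _)).trans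
    (.id_vcomp _ _)).trans (cls_out p)
  vcomp_id p _ := (cls_eq <| (Rel.vcomp _ (A.src_idm _).symm (.refl _) (out_cls _)).trans
    (.vcomp_id _ _)).trans (cls_out p)
  vcomp_assoc p q r h h' h₁ h₂ := cls_eq <|
    (Rel.vcomp _ ((A.tgt_vcomp _ _ _).trans h') (out_cls _) (.refl _)).trans <|
      (Rel.vcomp_assoc _ _ _ h h' _ (h.trans (A.src_vcomp _ _ _).symm)).trans <|
        .vcomp _ _ (.refl _) (out_cls _).symm
  vcomp_map f hf p q h h' := cls_eq <|
    (Rel.vcomp _ (by rw [A.tgt_map, A.src_map]; exact congrArg _ h) (out_cls _) (out_cls _)).trans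
      <| (Rel.vcomp_map f hf _ _ h _).trans (.map f hf (out_cls _).symm)
  vcomp_one h := cls_eq <|
    (Rel.vcomp h (by rw [A.tgt_idm, A.src_idm]) (out_cls _) (out_cls _)).trans <| by
      have e := Rel.id_vcomp (A := A) (R := R) (A.idm A.Ob.one) (by rw [A.tgt_idm])
      simp only [A.src_idm] at e
      exact e
  vcomp_comp p q ps qs h hs h' := cls_eq <|
    (Rel.vcomp _ (by
      rw [A.tgt_comp, A.src_comp]
      exact congrArg₂ A.Ob.comp h (funext hs)) (out_cls _) (out_cls _)).trans <|
      (Rel.vcomp_comp _ _ _ _ h hs _).trans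
        (.comp (out_cls _).symm fun _ => (out_cls _).symm)

end PreCatSystem

namespace CatSystem

variable {K : Kind}

/-- Forgetting the laws on arrows. -/
def toPre (A : CatSystem.{u} K) : PreCatSystem.{u} K where
  Ob := A.Ob
  Mor := A.Mor.word
  src := A.src.app
  tgt := A.tgt.app
  idm := A.idm.app
  vcomp := A.vcomp
  map := A.Mor.map
  comp := A.Mor.comp
  src_idm := A.src_idm
  tgt_idm := A.tgt_idm
  src_vcomp := A.src_vcomp
  tgt_vcomp := A.tgt_vcomp
  src_map := A.src.app_map
  tgt_map := A.tgt.app_map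
  src_comp := A.src.app_comp
  tgt_comp := A.tgt.app_comp

/-- The quotient of a categorical theory (or operad) `A` by a relation between parallel arrows:
the arrows are taken modulo the smallest congruence containing `R` (the axioms of a categorical
theory hold in `A` already). -/
noncomputable def quot (A : CatSystem.{u} K)
    (R : ∀ n, A.Mor.word n → A.Mor.word n → Prop) : CatSystem.{u} K :=
  A.toPre.quot R

end CatSystem

/-- A graphical pre-theory: a theory of objects and a collection of arrows with source, target and
identities, without composition. -/
structure GraphicalPreSystem (K : Kind) where
  Ob : OpSystem.{u} K
  Mor : ℕ → Type u
  src : ∀ {n : ℕ}, Mor n → Ob.word n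
  tgt : ∀ {n : ℕ}, Mor n → Ob.word n
  idm : ∀ {n : ℕ}, Ob.word n → Mor n
  src_idm : ∀ {n : ℕ} (a : Ob.word n), src (idm a) = a
  tgt_idm : ∀ {n : ℕ} (a : Ob.word n), tgt (idm a) = a

namespace GraphicalPreSystem

variable {K : Kind}

/-- Formal arrows with given source and target, built from the arrows of `G` by the operations of
a categorical theory. (The unit of the morphism theory is the identity of the unit.) -/
inductive Term (G : GraphicalPreSystem.{u} K) :
    ∀ n : ℕ, G.Ob.word n → G.Ob.word n → Type u
  | arrow {n : ℕ} (e : G.Mor n) : Term G n (G.src e) (G.tgt e)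
  | idm {n : ℕ} (a : G.Ob.word n) : Term G n a a
  | vcomp {n : ℕ} {a b b' c : G.Ob.word n} (s : Term G n a b) (h : b = b') (t : Term G n b' c) :
      Term G n a c
  | map {m n : ℕ} (f : Fin m → Fin n) (hf : K.Allowed f) {a b : G.Ob.word m}
      (t : Term G m a b) : Term G n (G.Ob.map f hf a) (G.Ob.map f hf b)
  | comp {k : ℕ} {n : Fin k → ℕ} {a b : G.Ob.word k} {as bs : ∀ i, G.Ob.word (n i)}
      (t : Term G k a b) (ts : ∀ i, Term G (n i) (as i) (bs i)) :
      Term G (∑ i, n i) (G.Ob.comp a as) (G.Ob.comp b bs)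

/-- Formal arrows with their operations. -/
def termSystem (G : GraphicalPreSystem.{u} K) : PreCatSystem.{u} K where
  Ob := G.Ob
  Mor n := Σ a b : G.Ob.word n, G.Term n a b
  src t := t.1
  tgt t := t.2.1
  idm a := ⟨a, a, .idm a⟩
  vcomp s t h := ⟨s.1, t.2.1, s.2.2.vcomp h t.2.2⟩
  map f hf t := ⟨_, _, t.2.2.map f hf⟩
  comp t ts := ⟨_, _, t.2.2.comp fun i => (ts i).2.2⟩
  src_idm _ := rfl
  tgt_idm _ := rfl
  src_vcomp _ _ _ := rfl
  tgt_vcomp _ _ _ := rfl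
  src_map _ _ _ := rfl
  tgt_map _ _ _ := rfl
  src_comp _ _ := rfl
  tgt_comp _ _ := rfl

/-- The formal arrow given by an identity of `G` is the formal identity. -/
inductive IdRel (G : GraphicalPreSystem.{u} K) :
    ∀ n, G.termSystem.Mor n → G.termSystem.Mor n → Prop
  | idm {n : ℕ} (a : G.Ob.word n) :
      IdRel G n ⟨_, _, .arrow (G.idm a)⟩ ⟨a, a, .idm a⟩

/-- The free categorical theory on the graphical pre-theory `G`: formal arrows modulo the axioms of
a categorical theory and the identities of `G`. Its object theory is that of `G`. -/
noncomputable def free (G : GraphicalPreSystem.{u} K) : CatSystem.{u} K :=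
  G.termSystem.quot G.IdRel

/-- The arrow of the free categorical theory given by an arrow of `G`. -/
def arrow (G : GraphicalPreSystem.{u} K) {n : ℕ} (e : G.Mor n) : G.free.Mor.word n :=
  G.termSystem.cls G.IdRel ⟨_, _, .arrow e⟩

end GraphicalPreSystem

/-- A Laplaza set for `T`: an arbitrary collection of sets of words. -/
abbrev LaplazaSet (T : Theory.{u}) := ∀ n, Set (T.word n)

namespace LaplazaSet

variable {T : Theory.{u}} (S : LaplazaSet T)

/-- The free theory on the collection `S`. -/
noncomputable def words : Theory.{u} := .free .theory fun n => S n

/-- The projection of the free theory on `S` to `T`. -/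
def proj : OpSystem.Hom S.words T := OpSystem.free.lift fun _ s => s.1

/-- `a` and `b` project to the same element of `S(n) ⊆ T(n)`. -/
def Coherent {n : ℕ} (a b : S.words.word n) : Prop :=
  S.proj.app a = S.proj.app b ∧ S.proj.app a ∈ S n

/-- The graphical pre-theory `G_S`: one arrow `a → b` whenever `a` and `b` project to the same
element of `S(n)`, which is the identity if `a = b`, and an identity for each further object. -/
noncomputable def graph : GraphicalPreSystem.{u} .theory where
  Ob := S.words
  Mor n := { e : S.words.word n × S.words.word n // e.1 = e.2 ∨ S.Coherent e.1 e.2 }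
  src e := e.1.1
  tgt e := e.1.2
  idm a := ⟨(a, a), .inl rfl⟩
  src_idm _ := rfl
  tgt_idm _ := rfl

/-- The arrow `ι_{a,b}` in the free categorical theory on `G_S`. -/
noncomputable def iota {n : ℕ} (a b : S.words.word n) (h : S.Coherent a b) : S.graph.free.Mor.word n :=
  S.graph.arrow ⟨(a, b), .inr h⟩

/-- The relations imposed on the free categorical theory `F_S` on `G_S`: `ι_{a,b}` and `ι_{b,a}` are
mutually inverse, and any two arrows `x → y` are equal if `x` and `y` project to the same element of
`S(n)`. -/
inductive CohRel : ∀ n, S.graph.free.Mor.word n → S.graph.free.Mor.word n → Prop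
  | inv {n : ℕ} (a b : S.words.word n) (h : S.Coherent a b) (h' : S.Coherent b a) (e) :
      CohRel n (S.graph.free.vcomp (S.iota a b h) (S.iota b a h') e) (S.graph.free.idm.app a)
  | coh {n : ℕ} (α β : S.graph.free.Mor.word n)
      (hs : S.graph.free.src.app α = S.graph.free.src.app β)
      (ht : S.graph.free.tgt.app α = S.graph.free.tgt.app β)
      (h : S.Coherent (S.graph.free.src.app α) (S.graph.free.tgt.app α)) :
      CohRel n α β

/-- The categorical theory `T'_S`. -/
noncomputable def pseudo : CatTheory.{u} := S.graph.free.quot S.CohRel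

end LaplazaSet

namespace OpSystem

/-- The free operad on the collection `C(n)`. -/
noncomputable def opWords (C : Operad.{u}) : Operad.{u} := .free .operad C.word

/-- The projection of the free operad on the collection `C(n)` to `C`. -/
def opProj (C : Operad.{u}) : Hom C.opWords C := free.lift fun _ c => c

/-- The categorical operad `C'`: its objects form the free operad on the collection `C(n)`, and
there is exactly one arrow from `a` to `b` if they project to the same element of `C`, and none
otherwise. -/
noncomputable def pseudo (C : Operad.{u}) : CatOperad.{u} where
  Ob := C.opWords
  Mor :=
    { word := fun n => { e : C.opWords.word n × C.opWords.word n //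
        C.opProj.app e.1 = C.opProj.app e.2 }
      map := fun f hf e => ⟨(C.opWords.map f hf e.1.1, C.opWords.map f hf e.1.2), by
        rw [C.opProj.app_map, C.opProj.app_map, e.2]⟩
      one := ⟨(C.opWords.one, C.opWords.one), rfl⟩
      comp := fun e es => ⟨(C.opWords.comp e.1.1 fun i => (es i).1.1,
          C.opWords.comp e.1.2 fun i => (es i).1.2), by
        simp only [C.opProj.app_comp, e.2, fun i => (es i).2]⟩
      map_id := fun e => Subtype.ext (Prod.ext (C.opWords.map_id _) (C.opWords.map_id _))
      map_map := fun g hg f hf e => Subtype.ext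
        (Prod.ext (C.opWords.map_map g hg f hf _) (C.opWords.map_map g hg f hf _))
      comp_assoc := fun _ _ _ => Subtype.ext
        (Prod.ext (C.opWords.comp_assoc _ _ _) (C.opWords.comp_assoc _ _ _))
      comp_one := fun _ => Subtype.ext (Prod.ext (C.opWords.comp_one _) (C.opWords.comp_one _))
      one_comp := fun _ => Subtype.ext (Prod.ext (C.opWords.one_comp _) (C.opWords.one_comp _))
      map_comp := fun f hf _ _ => Subtype.ext
        (Prod.ext (C.opWords.map_comp f hf _ _) (C.opWords.map_comp f hf _ _))
      comp_map := fun g hg _ _ => Subtype.ext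
        (Prod.ext (C.opWords.comp_map g hg _ _) (C.opWords.comp_map g hg _ _)) }
  src := ⟨fun e => e.1.1, fun _ _ _ => rfl, rfl, fun _ _ => rfl⟩
  tgt := ⟨fun e => e.1.2, fun _ _ _ => rfl, rfl, fun _ _ => rfl⟩
  idm := ⟨fun a => ⟨(a, a), rfl⟩, fun _ _ _ => rfl, rfl, fun _ _ => rfl⟩
  vcomp e e' h := ⟨(e.1.1, e'.1.2), e.2.trans ((congrArg C.opProj.app h).trans e'.2)⟩
  src_idm _ := rfl
  tgt_idm _ := rfl
  src_vcomp _ _ _ := rfl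
  tgt_vcomp _ _ _ := rfl
  id_vcomp _ _ := rfl
  vcomp_id _ _ := rfl
  vcomp_assoc _ _ _ _ _ _ _ := rfl
  vcomp_map _ _ _ _ _ _ := rfl
  vcomp_one _ := rfl
  vcomp_comp _ _ _ _ _ _ _ := rfl

end OpSystem

/-- Words with variables and simultaneous substitution; an auxiliary device to construct theories. -/
structure Clone where
  word : ℕ → Type u
  var : ∀ {n : ℕ}, Fin n → word n
  subst : ∀ {k n : ℕ}, word k → (Fin k → word n) → word n
  var_subst : ∀ {k n : ℕ} (i : Fin k) (ws : Fin k → word n), subst (var i) ws = ws i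
  subst_var : ∀ {k : ℕ} (w : word k), subst w var = w
  subst_subst : ∀ {k l n : ℕ} (w : word k) (ws : Fin k → word l) (us : Fin l → word n),
    subst (subst w ws) us = subst w fun i => subst (ws i) us

namespace Clone

/-- The theory of a clone: the action of `f` renames variables, and `γ(w; w₁, …, w_k)` substitutes
the `wᵢ`, in consecutive blocks of variables, into `w`. -/
def toTheory (A : Clone.{u}) : Theory.{u} where
  word := A.word
  map f _ w := A.subst w fun x => A.var (f x)
  one := A.var 0
  comp {_ n} w ws := A.subst w fun i => A.subst (ws i) fun x => A.var (blockPos n ⟨i, x⟩)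
  map_id w := A.subst_var w
  map_map g _ f _ w := by simp only [subst_subst, var_subst]
  comp_assoc {k n m} w ws us := by
    simp only [subst_subst, var_subst, blockPos_assoc]
    have key : ∀ (s t : Σ i, Fin (n i)) (e : s = t) {N : ℕ} (g : Fin (m s.1 s.2) → Fin N),
        A.subst (us s.1 s.2) (fun x => A.var (g x)) =
          A.subst (us t.1 t.2) fun x => A.var (g (Fin.cast (by rw [e]) x)) := by
      rintro s _ rfl N g
      rfl
    refine congrArg _ (funext fun i => congrArg _ (funext fun j => ?_))
    exact (key _ ⟨i, j⟩ ((blockPos n).symm_apply_apply ⟨i, j⟩) fun x =>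
      blockPos (fun p => m ((blockPos n).symm p).1 ((blockPos n).symm p).2)
        ⟨blockPos n ⟨i, j⟩, x⟩).symm
  comp_one w := by simp only [var_subst, blockPos_one]
  one_comp w := by simp only [var_subst, one_blockPos]
  map_comp f _ w ws := by
    simp only [subst_subst, var_subst, blockMap_blockPos]
  comp_map g _ w ws := by
    simp only [subst_subst, var_subst, blockSum_blockPos]

end Clone

section EndCat

open CategoryTheory

variable (X : Type w) [Category.{v} X]

/-- The functor `x ↦ (F₁ x, …, F_k x)`. -/
def tuple {X : Type w} [Category.{v} X] {k n : ℕ} (Fs : Fin k → (Fin n → X) ⥤ X) : (Fin n → X) ⥤ (Fin k → X) where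
  obj x i := (Fs i).obj x
  map g i := (Fs i).map g
  map_id x := funext fun i => (Fs i).map_id x
  map_comp g g' := funext fun i => (Fs i).map_comp g g'

/-- The natural transformation `(α₁, …, α_k)`. -/
def tupleHom {X : Type w} [Category.{v} X] {k n : ℕ} {Fs Gs : Fin k → (Fin n → X) ⥤ X}
    (αs : ∀ i, Fs i ⟶ Gs i) : tuple Fs ⟶ tuple Gs where
  app x i := (αs i).app x
  naturality _ _ g := funext fun i => (αs i).naturality g

/-- Natural transformations between functors `Xⁿ ⥤ X`, with their sources and targets. -/
abbrev EndArrow (n : ℕ) : Type (max v w) := Σ F G : (Fin n → X) ⥤ X, (F ⟶ G)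

/-- Functors `Xⁿ ⥤ X`: variables are projections, substitution is composition of functors. -/
def endObjClone : Clone.{max v w} where
  word n := (Fin n → X) ⥤ X
  var i := Pi.eval _ i
  subst F Fs := tuple Fs ⋙ F
  var_subst _ _ := rfl
  subst_var _ := rfl
  subst_subst _ _ _ := rfl

theorem EndArrow.ext {X : Type w} [Category.{v} X] {n : ℕ} {F G : (Fin n → X) ⥤ X} {α β : F ⟶ G} (h : ∀ x, α.app x = β.app x) :
    (⟨F, G, α⟩ : EndArrow X n) = ⟨F, G, β⟩ :=
  congrArg (fun γ : F ⟶ G => (⟨F, G, γ⟩ : EndArrow X n)) (NatTrans.ext (funext h))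

/-- Natural transformations between functors `Xⁿ ⥤ X`: substitution is horizontal composition. -/
def endMorClone : Clone.{max v w} where
  word n := EndArrow X n
  var i := ⟨Pi.eval _ i, Pi.eval _ i, 𝟙 _⟩
  subst α αs := ⟨tuple (fun i => (αs i).1) ⋙ α.1, tuple (fun i => (αs i).2.1) ⋙ α.2.1,
    tupleHom (fun i => (αs i).2.2) ◫ α.2.2⟩
  var_subst _ _ := EndArrow.ext fun _ => Category.id_comp _
  subst_var α := EndArrow.ext fun x =>
    (congrArg (α.2.2.app x ≫ ·) (α.2.1.map_id x)).trans (Category.comp_id _)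
  subst_subst α _ _ := EndArrow.ext fun _ =>
    (Category.assoc _ _ _).trans (congrArg (_ ≫ ·) (α.2.1.map_comp _ _).symm)

/-- Identity natural transformations. -/
def EndArrow.id {n : ℕ} (F : (Fin n → X) ⥤ X) : EndArrow X n := ⟨F, F, 𝟙 F⟩

/-- Vertical composition. -/
def EndArrow.vcomp {n : ℕ} (α β : EndArrow X n) (h : α.2.1 = β.1) : EndArrow X n :=
  ⟨α.1, β.2.1, α.2.2 ≫ eqToHom h ≫ β.2.2⟩

theorem EndArrow.vcomp_self {n : ℕ} {F G H : (Fin n → X) ⥤ X} (α : F ⟶ G) (β : G ⟶ H) (h) :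
    EndArrow.vcomp X ⟨F, G, α⟩ ⟨G, H, β⟩ h = ⟨F, H, α ≫ β⟩ := by
  simp only [EndArrow.vcomp, eqToHom_refl, Category.id_comp]

theorem EndArrow.vcomp_subst {k n : ℕ} (α β : EndArrow X k)
    (αs βs : Fin k → EndArrow X n) (h : α.2.1 = β.1) (hs : ∀ i, (αs i).2.1 = (βs i).1) (h') :
    EndArrow.vcomp X ((endMorClone X).subst α αs) ((endMorClone X).subst β βs) h' =
      (endMorClone X).subst (EndArrow.vcomp X α β h)
        fun i => EndArrow.vcomp X (αs i) (βs i) (hs i) := by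
  obtain ⟨F, G, α⟩ := α
  obtain ⟨G', H, β⟩ := β
  obtain rfl : G = G' := h
  obtain ⟨Fs, Gs, as, rfl⟩ : ∃ (Fs Gs : Fin k → (Fin n → X) ⥤ X) (as : ∀ i, Fs i ⟶ Gs i),
      αs = fun i => ⟨Fs i, Gs i, as i⟩ := ⟨_, _, fun i => (αs i).2.2, rfl⟩
  obtain ⟨Gs', Hs, bs, rfl⟩ : ∃ (Gs' Hs : Fin k → (Fin n → X) ⥤ X) (bs : ∀ i, Gs' i ⟶ Hs i),
      βs = fun i => ⟨Gs' i, Hs i, bs i⟩ := ⟨_, _, fun i => (βs i).2.2, rfl⟩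
  obtain rfl : Gs = Gs' := funext hs
  simp only [EndArrow.vcomp_self]
  exact (EndArrow.vcomp_self X (tupleHom as ◫ α) (tupleHom bs ◫ β) h').trans
    (congrArg (fun γ => (⟨tuple Fs ⋙ F, tuple Hs ⋙ H, γ⟩ : EndArrow X n))
      (NatTrans.exchange (tupleHom as) (tupleHom bs) α β).symm)

theorem endId_subst {k n : ℕ} (F : (Fin k → X) ⥤ X) (Fs : Fin k → (Fin n → X) ⥤ X) :
    EndArrow.id X (tuple Fs ⋙ F) =
      (endMorClone X).subst (EndArrow.id X F) fun i => EndArrow.id X (Fs i) :=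
  EndArrow.ext fun _ => ((Category.id_comp _).trans (F.map_id _)).symm

/-- The endomorphism theory `End_Cat(X)`: functors `Xⁿ ⥤ X` and natural transformations. -/
def endCat : CatTheory.{max v w} where
  Ob := (endObjClone X).toTheory
  Mor := (endMorClone X).toTheory
  src := ⟨fun α => α.1, fun _ _ _ => rfl, rfl, fun _ _ => rfl⟩
  tgt := ⟨fun α => α.2.1, fun _ _ _ => rfl, rfl, fun _ _ => rfl⟩
  idm :=
    { app := EndArrow.id X
      app_map := fun f hf F => endId_subst X F fun x => Pi.eval _ (f x)
      app_one := rfl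
      app_comp := fun F Fs => (endId_subst X F _).trans <|
        congrArg ((endMorClone X).subst (EndArrow.id X F)) <| funext fun i => endId_subst X (Fs i) _ }
  vcomp := EndArrow.vcomp X
  src_idm _ := rfl
  tgt_idm _ := rfl
  src_vcomp _ _ _ := rfl
  tgt_vcomp _ _ _ := rfl
  id_vcomp := fun ⟨F, G, α⟩ h => (EndArrow.vcomp_self X (𝟙 F) α h).trans
    (EndArrow.ext fun _ => Category.id_comp _)
  vcomp_id := fun ⟨F, G, α⟩ h => (EndArrow.vcomp_self X α (𝟙 G) h).trans
    (EndArrow.ext fun _ => Category.comp_id _)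
  vcomp_assoc := by
    rintro n ⟨F, G, α⟩ ⟨G', H, β⟩ ⟨H', I, γ⟩ h h' h₁ h₂
    obtain rfl : G = G' := h
    obtain rfl : H = H' := h'
    change EndArrow.vcomp X (EndArrow.vcomp X _ _ _) _ _ = EndArrow.vcomp X _ (EndArrow.vcomp X _ _ _) _
    simp only [EndArrow.vcomp_self, Category.assoc]
  vcomp_map f hf α β h h' := (EndArrow.vcomp_subst X α β _ _ h (fun _ => rfl) h').trans <|
    congrArg ((endMorClone X).subst _) <| funext fun i =>
      (EndArrow.vcomp_self X _ _ _).trans (EndArrow.ext fun _ => Category.comp_id _)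
  vcomp_one h := (EndArrow.vcomp_self X _ _ h).trans (EndArrow.ext fun _ => Category.comp_id _)
  vcomp_comp {k n} α β αs βs h hs h' :=
    (EndArrow.vcomp_subst X α β _ _ h (fun i => congrArg (tuple _ ⋙ ·) (hs i)) h').trans <|
    congrArg ((endMorClone X).subst _) <| funext fun i =>
      (EndArrow.vcomp_subst X (αs i) (βs i) _ _ (hs i) (fun _ => rfl) _).trans <|
        congrArg ((endMorClone X).subst _) <| funext fun j =>
          (EndArrow.vcomp_self X _ _ _).trans (EndArrow.ext fun _ => Category.comp_id _)

theorem endCat_map_obj {m n : ℕ} (f : Fin m → Fin n) (F : (Fin m → X) ⥤ X) (x : Fin n → X) :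
    ((endCat X).Ob.map f (.theory f) F : (Fin n → X) ⥤ X).obj x = F.obj fun i => x (f i) :=
  rfl

theorem endCat_comp_obj {k : ℕ} {n : Fin k → ℕ} (F : (Fin k → X) ⥤ X)
    (Fs : ∀ i, (Fin (n i) → X) ⥤ X) (x : Fin (∑ i, n i) → X) :
    ((endCat X).Ob.comp F Fs : (Fin (∑ i, n i) → X) ⥤ X).obj x =
      F.obj fun i => (Fs i).obj fun j => x (blockPos n ⟨i, j⟩) :=
  rfl

/-- A pseudo `(T, S)`-algebra structure on the category `X`: a morphism of categorical theories
`T'_S → End_Cat(X)`. -/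
abbrev PseudoAlgebra {T : Theory.{u}} (S : LaplazaSet T) (X : Type w) [Category.{v} X] :=
  CatSystem.Hom S.pseudo (endCat X)

/-- A pseudo `C`-algebra structure on the category `X`: a morphism of categorical operads
`C' → End_Cat(X)`. -/
abbrev PseudoOperadAlgebra (C : Operad.{u}) (X : Type w) [Category.{v} X] :=
  CatSystem.Hom C.pseudo (endCat X).toOperad

end EndCat

/-- The Laplaza set `C ⊆ T` of a theory `T` under an operad `C`. -/
def OpSystem.Hom.laplazaSet {C : Operad.{u}} {T : Theory.{u}} (η : OpSystem.Hom C T.toOperad) :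
    LaplazaSet T :=
  fun n => Set.range (η.app (n := n))

/-- The generator of the object theory of `T'_S` given by a word of the operad. -/
noncomputable def OpSystem.Hom.laplazaGen {C : Operad.{u}} {T : Theory.{u}}
    (η : OpSystem.Hom C T.toOperad) {n : ℕ} (c : C.word n) : η.laplazaSet.pseudo.Ob.word n :=
  OpSystem.free.gen (Z := fun n => η.laplazaSet n) ⟨η.app c, c, rfl⟩

/-!
The free theory on an operad `D` has a normal form: its words are the pairs `(d, f)` of a word `d`
of `D` and a map `f` that labels the inputs of `d` by variables, and two pairs agree only if they
differ by a bijective renumbering of the inputs. It is constructed here as a clone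
(`freeTheory`), and the normal form is transported to any free theory
(`IsFreeTheoryOn.exists_map_eq`, `IsFreeTheoryOn.exists_bijective`). In particular `η` is injective,
so the free theory on `S = η(C)` is the free theory on the free operad on `C`
(`isFreeTheoryOn_laplazaOb`), and the normal form applies to the objects of `T'_S` as well as to
`T`. Comparing the two shows that an object of `T'_S` that projects to `S` is the image of a unique
object of `C'` (`exists_laplazaOb_eq`, `laplazaOb_injective`). Thus the generating arrows `ι_{a,b}`
of `T'_S` are precisely the images of the arrows of `C'`, which yields `κ` (`comparison`); the
coherence relation of `T'_S` makes `κ` functorial and unique.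

For the universal property, a morphism `φ : C' → E` determines values of the objects and of the
`ι_{a,b}`, hence a morphism `F_S → E`, and it remains to see that the coherence relation holds in
`E`. Every arrow of `F_S` is sent to `φ(e)_f` for an arrow `e` of `C'` and a map `f`, with source
and target presented by the same `e` and `f` (`Lifts`): this is clear for generators and stable
under the operations, and for a vertical composite the two normal forms of the middle object are
matched by a bijection (`Lifts.vcomp`). If the source projects to `S`, then `f` is bijective, so
that the value is `φ` of an arrow of `C'`, which is determined by its endpoints (`Lifts.unique`).
The universal property holds against categorical theories in every universe, so it covers
`End_Cat(X)`, and the statement about pseudo algebras is the special case `E = End_Cat(X)`.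
-/

/-! ### The free theory on an operad -/

namespace OpSystem

variable {K : Kind}

theorem map_congr (A : OpSystem.{u} K) {m n : ℕ} {f g : Fin m → Fin n} (hf : K.Allowed f)
    (hg : K.Allowed g) (h : ∀ x, f x = g x) (w : A.word m) : A.map f hf w = A.map g hg w := by
  obtain rfl : f = g := funext h
  rfl

theorem map_eq_self (A : OpSystem.{u} K) {n : ℕ} {f : Fin n → Fin n} (hf : K.Allowed f)
    (h : ∀ x, f x = x) (w : A.word n) : A.map f hf w = w :=
  (A.map_congr hf (.id n) h w).trans (A.map_id w)

/-- The composite in a theory of two levels of relabelled words is a relabelled composite. -/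
theorem comp_map_map (A : Theory.{w}) {l : ℕ} {n : Fin l → ℕ} {k : ℕ}
    {m : Fin l → ℕ} (f : Fin k → Fin l) (g : ∀ j, Fin (m j) → Fin (n j)) (x : A.word k)
    (xs : ∀ j, A.word (m j)) :
    A.map (fun y => blockMap f n (blockSum (fun i => g (f i)) y)) (.theory _)
        (A.comp x fun i => xs (f i)) =
      A.comp (A.map f (.theory f) x) fun j => A.map (g j) (.theory _) (xs j) := by
  refine Eq.symm <| (A.map_comp f (.theory f) x _).trans ?_
  refine (congrArg (A.map _ (.theory _)) (A.comp_map (fun i => g (f i)) (fun _ => .theory _) x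
    fun i => xs (f i))).trans ?_
  exact A.map_map _ _ _ _ _

/-- Words `w` of an operad whose inputs are labelled by variables among `1, …, n`, by a map `f`
that may repeat and omit variables. -/
structure Labelled (D : Operad.{u}) (n : ℕ) where
  arity : ℕ
  label : Fin arity → Fin n
  word : D.word arity

namespace Labelled

variable {D : Operad.{u}}

/-- Two labelled words are identified if they differ by a bijective renumbering of the inputs. -/
def Equivalent {n : ℕ} (a b : Labelled D n) : Prop :=
  ∃ (σ : Fin a.arity → Fin b.arity) (hσ : Kind.operad.Allowed σ),
    (∀ x, b.label (σ x) = a.label x) ∧ D.map σ hσ a.word = b.word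

theorem Equivalent.refl {n : ℕ} (a : Labelled D n) : Equivalent a a :=
  ⟨fun x => x, .id _, fun _ => rfl, D.map_id _⟩

theorem Equivalent.symm {n : ℕ} {a b : Labelled D n} : Equivalent a b → Equivalent b a := by
  rintro ⟨σ, hσ, hl, hw⟩
  let e := Equiv.ofBijective σ hσ
  refine ⟨e.symm, .of_bijective e.symm.bijective, fun x => ?_, ?_⟩
  · rw [← hl]
    exact congrArg b.label (e.apply_symm_apply x)
  · rw [← hw, D.map_map (hg := .of_bijective e.symm.bijective)]
    exact D.map_eq_self _ e.symm_apply_apply _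

theorem Equivalent.trans {n : ℕ} {a b c : Labelled D n} :
    Equivalent a b → Equivalent b c → Equivalent a c := by
  rintro ⟨σ, hσ, hl, hw⟩ ⟨τ, hτ, hl', hw'⟩
  refine ⟨fun x => τ (σ x), Kind.Allowed.comp hτ hσ, fun x => (hl' _).trans (hl x), ?_⟩
  rw [← hw', ← hw, D.map_map]

/-- Equivalence of labelled words as a setoid. -/
def setoid (D : Operad.{u}) (n : ℕ) : Setoid (Labelled D n) where
  r := Equivalent
  iseqv := ⟨.refl, .symm, .trans⟩

/-- The variable `i`: the unit, with its input labelled `i`. -/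
def var (D : Operad.{u}) {n : ℕ} (i : Fin n) : Labelled D n := ⟨1, fun _ => i, D.one⟩

/-- Substitution of the labelled words `b₁, …, b_k` for the variables in `a`. -/
def subst {k n : ℕ} (a : Labelled D k) (b : Fin k → Labelled D n) : Labelled D n where
  arity := ∑ x, (b (a.label x)).arity
  label p := (b (a.label ((blockPos _).symm p).1)).label ((blockPos _).symm p).2
  word := D.comp a.word fun x => (b (a.label x)).word

theorem subst_label {k n : ℕ} (a : Labelled D k) (b : Fin k → Labelled D n) (x : Fin a.arity)
    (y : Fin (b (a.label x)).arity) :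
    (subst a b).label (blockPos (fun x => (b (a.label x)).arity) ⟨x, y⟩) =
      (b (a.label x)).label y :=
  congrArg (fun s : Σ x, Fin (b (a.label x)).arity => (b (a.label s.1)).label s.2)
    (Equiv.symm_apply_apply _ _)

theorem subst_label_of_eq {k n : ℕ} (a : Labelled D k) (b : Fin k → Labelled D n)
    (x : Fin a.arity) (y : Fin (b (a.label x)).arity) {p : Fin (∑ x, (b (a.label x)).arity)}
    (h : blockPos (fun x => (b (a.label x)).arity) ⟨x, y⟩ = p) :
    (subst a b).label p = (b (a.label x)).label y :=
  h ▸ subst_label a b x y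

/-- Statements about an element of `n₁ + ⋯ + n_k` may be checked block by block. -/
theorem forall_blockPos {k : ℕ} {n : Fin k → ℕ} {P : Fin (∑ i, n i) → Prop}
    (h : ∀ i x, P (blockPos n ⟨i, x⟩)) (p : Fin (∑ i, n i)) : P p := by
  obtain ⟨⟨i, x⟩, rfl⟩ := (blockPos n).surjective p
  exact h i x

theorem Equivalent.subst_left {k n : ℕ} {a a' : Labelled D k} (h : Equivalent a a')
    (b : Fin k → Labelled D n) : Equivalent (subst a b) (subst a' b) := by
  obtain ⟨r, l, w⟩ := a
  obtain ⟨r', l', w'⟩ := a'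
  have key : ∀ (σ : Fin r → Fin r') (hσ : Kind.operad.Allowed σ), l = (fun x => l' (σ x)) →
      D.map σ hσ w = w' → Equivalent (subst ⟨r, l, w⟩ b) (subst ⟨r', l', w'⟩ b) := by
    rintro σ hσ rfl rfl
    refine ⟨blockMap σ fun x => (b (l' x)).arity, hσ.blockMap _,
      forall_blockPos fun x y => ?_, (D.map_comp σ hσ w fun x => (b (l' x)).word).symm⟩
    erw [blockMap_blockPos, subst_label, subst_label]
  obtain ⟨σ, hσ, hl, hw⟩ := h
  exact key σ hσ (funext fun x => (hl x).symm) hw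

theorem Equivalent.subst_right {k n : ℕ} (a : Labelled D k) {b b' : Fin k → Labelled D n}
    (h : ∀ i, Equivalent (b i) (b' i)) : Equivalent (subst a b) (subst a b') := by
  choose σ hσ hl hw using h
  refine ⟨blockSum fun x => σ (a.label x),
    Kind.Allowed.blockSum (K := .operad) fun x => hσ (a.label x),
    forall_blockPos fun x y => ?_, ?_⟩
  · erw [blockSum_blockPos, subst_label, subst_label]
    exact hl _ _
  · refine (D.comp_map (fun x => σ (a.label x)) (fun x => hσ _) _ _).symm.trans ?_
    exact congrArg (D.comp a.word) (funext fun x => hw _)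

theorem var_subst {k n : ℕ} (i : Fin k) (b : Fin k → Labelled D n) :
    Equivalent (subst (var D i) b) (b i) := by
  refine .symm ⟨Fin.cast (one_arity _), .cast _, fun x => ?_, (D.one_comp _).symm⟩
  exact subst_label_of_eq (var D i) b (0 : Fin 1) x (one_blockPos 0 x)

theorem subst_var {k : ℕ} (a : Labelled D k) : Equivalent (subst a (var D)) a := by
  refine .symm ⟨Fin.cast (unit_arity _), .cast _, fun x => ?_, (D.comp_one _).symm⟩
  exact subst_label_of_eq a (var D) x (0 : Fin 1) (blockPos_one x 0)

theorem subst_subst {k l n : ℕ} (a : Labelled D k) (b : Fin k → Labelled D l)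
    (c : Fin l → Labelled D n) :
    Equivalent (subst (subst a b) c) (subst a fun i => subst (b i) c) := by
  refine .symm ⟨Fin.cast (assoc_arity (fun x => (b (a.label x)).arity)
      fun x y => (c ((b (a.label x)).label y)).arity), .cast _,
    forall_blockPos fun x => forall_blockPos fun y z => ?_, D.comp_assoc _ _ _⟩
  have key : ∀ (p q : Fin l) (e : p = q) (z : Fin (c q).arity),
      (c p).label (Fin.cast (by rw [e]) z) = (c q).label z := by
    rintro p _ rfl z
    rfl
  erw [blockPos_assoc (fun x => (b (a.label x)).arity)
      (fun x y => (c ((b (a.label x)).label y)).arity),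
    subst_label (subst a b) c, subst_label a (fun i => subst (b i) c) x, subst_label (b _) c y]
  exact key _ _ (subst_label a b x y) z

theorem Equivalent.out {n : ℕ} (a : Labelled D n) :
    Equivalent (Quotient.mk (setoid D n) a).out a :=
  Quotient.exact (s := setoid D n) (Quotient.out_eq _)

end Labelled

/-- Labelled words, up to renumbering of the inputs, with substitution. -/
noncomputable def labelledClone (D : Operad.{u}) : Clone.{u} where
  word n := Quotient (Labelled.setoid D n)
  var i := Quotient.mk _ (.var D i)
  subst a b := Quotient.mk _ (a.out.subst fun i => (b i).out)
  var_subst i _ := (Quotient.sound (s := Labelled.setoid D _) <|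
    (Labelled.Equivalent.subst_left (.out _) _).trans
      (Labelled.var_subst i _)).trans (Quotient.out_eq _)
  subst_var _ := (Quotient.sound (s := Labelled.setoid D _) <|
    (Labelled.Equivalent.subst_right _ fun _ => .out _).trans
      (Labelled.subst_var _)).trans (Quotient.out_eq _)
  subst_subst _ b c := Quotient.sound (s := Labelled.setoid D _) <|
    ((Labelled.Equivalent.subst_left (.out _) _).trans (Labelled.subst_subst _ _ _)).trans
      (.subst_right _ fun i => .symm (.out ((b i).out.subst fun j => (c j).out)))

/-- The free theory on the operad `D`. -/
noncomputable def freeTheory (D : Operad.{u}) : Theory.{u} := D.labelledClone.toTheory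

/-- The word of the free theory given by a labelled word of the operad. -/
def freeTheoryMk {D : Operad.{u}} {n : ℕ} (a : Labelled D n) : D.freeTheory.word n :=
  Quotient.mk (Labelled.setoid D n) a

theorem freeTheoryMk_eq_iff {D : Operad.{u}} {n : ℕ} {a b : Labelled D n} :
    freeTheoryMk a = freeTheoryMk b ↔ a.Equivalent b :=
  Quotient.eq (r := Labelled.setoid D n)

theorem exists_freeTheoryMk {D : Operad.{u}} {n : ℕ} (w : D.freeTheory.word n) :
    ∃ a : Labelled D n, freeTheoryMk a = w :=
  Quotient.exists_rep (s := Labelled.setoid D n) w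

theorem labelledClone_subst {D : Operad.{u}} {k n : ℕ} (a : Labelled D k)
    (b : Fin k → Labelled D n) :
    D.labelledClone.subst (freeTheoryMk a) (fun i => freeTheoryMk (b i)) =
      freeTheoryMk (a.subst b) :=
  freeTheoryMk_eq_iff.2 <| (Labelled.Equivalent.subst_left (.out _) _).trans
    (.subst_right _ fun _ => .out _)

theorem freeTheory_map {D : Operad.{u}} {m n : ℕ} (f : Fin m → Fin n) (hf) (a : Labelled D m) :
    D.freeTheory.map f hf (freeTheoryMk a) =
      freeTheoryMk ⟨a.arity, fun x => f (a.label x), a.word⟩ := by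
  refine (labelledClone_subst a fun x => .var D (f x)).trans (freeTheoryMk_eq_iff.2 ?_)
  exact Labelled.subst_var (⟨a.arity, fun x => f (a.label x), a.word⟩ : Labelled D n)

theorem freeTheory_comp {D : Operad.{u}} {k : ℕ} {n : Fin k → ℕ} (a : Labelled D k)
    (b : ∀ i, Labelled D (n i)) :
    D.freeTheory.comp (freeTheoryMk a) (fun i => freeTheoryMk (b i)) =
      freeTheoryMk (a.subst fun i =>
        ⟨(b i).arity, fun x => blockPos n ⟨i, (b i).label x⟩, (b i).word⟩) := by
  refine Eq.trans ?_ (labelledClone_subst a fun i =>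
      ⟨(b i).arity, fun x => blockPos n ⟨i, (b i).label x⟩, (b i).word⟩)
  exact congrArg (D.labelledClone.subst _) <| funext fun i =>
    freeTheory_map (fun x => blockPos n ⟨i, x⟩) (.theory _) (b i)

/-- The unit of the free theory labels the inputs of a word from left to right. -/
noncomputable def freeTheoryUnit (D : Operad.{u}) : Hom D D.freeTheory.toOperad where
  app {n} w := freeTheoryMk ⟨n, fun x => x, w⟩
  app_map f hf w := by
    refine Eq.trans ?_ (freeTheory_map f (.theory _) _).symm
    exact freeTheoryMk_eq_iff.2 (.symm ⟨f, hf, fun _ => rfl, rfl⟩)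
  app_one := freeTheoryMk_eq_iff.2 ⟨fun x => x, .id _, fun x => Subsingleton.elim _ _,
    D.map_id _⟩
  app_comp {k n} w ws := by
    refine Eq.trans ?_ (freeTheory_comp _ _).symm
    exact freeTheoryMk_eq_iff.2 ⟨fun x => x, .id _,
      Labelled.forall_blockPos fun i x =>
      Labelled.subst_label ⟨k, fun x => x, w⟩
        (fun i => ⟨n i, fun x => blockPos n ⟨i, x⟩, ws i⟩) i x, D.map_id _⟩

/-- The morphism from the free theory on `D` that extends a morphism of operads on `D`. -/
def freeTheoryLift {D : Operad.{u}} {E : Theory.{v}} (φ : Hom D E.toOperad) :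
    Hom D.freeTheory E where
  app := Quotient.lift (fun a : Labelled D _ => E.map a.label (.theory _) (φ.app a.word)) (by
    rintro a b ⟨σ, hσ, hl, hw⟩
    rw [← hw, φ.app_map]
    refine Eq.trans ?_ (E.map_map _ (.theory _) _ (.theory _) _).symm
    exact E.map_congr _ _ (fun x => (hl x).symm) _)
  app_map f hf w := by
    obtain ⟨a, rfl⟩ := exists_freeTheoryMk w
    rw [freeTheory_map]
    exact (E.map_map f hf a.label (.theory _) (φ.app a.word)).symm
  app_one :=
    (E.map_eq_self (.theory _) (fun _ => Subsingleton.elim (α := Fin 1) _ _) _).trans φ.app_one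
  app_comp {k n} w ws := by
    obtain ⟨a, rfl⟩ := exists_freeTheoryMk w
    choose b hb using fun i => exists_freeTheoryMk (ws i)
    obtain rfl : (fun i => freeTheoryMk (b i)) = ws := funext hb
    rw [freeTheory_comp]
    refine Eq.trans ?_ (E.map_comp a.label (.theory _) (φ.app a.word)
      fun i => E.map (b i).label (.theory _) (φ.app (b i).word)).symm
    refine Eq.trans ?_ (congrArg (E.map _ _) (E.comp_map (fun x => (b (a.label x)).label)
      (fun _ => .theory _) (φ.app a.word) fun x => φ.app (b (a.label x)).word)).symm
    refine Eq.trans ?_ (E.map_map _ _ _ _ _).symm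
    refine (congrArg (E.map _ (.theory _)) (φ.app_comp _ _)).trans (E.map_congr _ _ ?_ _)
    refine Labelled.forall_blockPos fun i x => ?_
    erw [blockSum_blockPos, blockMap_blockPos, Labelled.subst_label]

theorem freeTheoryLift_unit {D : Operad.{u}} {E : Theory.{v}} (φ : Hom D E.toOperad) {n : ℕ}
    (d : D.word n) : (freeTheoryLift φ).app (D.freeTheoryUnit.app d) = φ.app d :=
  E.map_id (φ.app d)

end OpSystem

namespace IsFreeTheoryOn

open OpSystem

variable {C : Operad.{u}} {T : Theory.{u}} {η : Hom C T.toOperad}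

/-- A word of the free theory on an operad is a word of the operad with relabelled inputs. -/
theorem exists_map_eq (hη : IsFreeTheoryOn η) {n : ℕ} (w : T.word n) :
    ∃ (k : ℕ) (f : Fin k → Fin n) (c : C.word k), T.map f (.theory f) (η.app c) = w := by
  obtain ⟨ρ, hρ, -⟩ := hη _ C.freeTheoryUnit
  have hid : (freeTheoryLift η).comp ρ = Hom.id T := by
    refine (hη T η).unique ?_ rfl
    have h : ∀ {n : ℕ} (c : C.word n), ρ.app (η.app c) = C.freeTheoryUnit.app c := fun c =>
      congrArg (fun χ : Hom C C.freeTheory.toOperad => χ.app c) hρ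
    refine Hom.ext (funext fun n => funext fun c => ?_)
    exact (congrArg (freeTheoryLift η).app (h c)).trans (freeTheoryLift_unit η c)
  have hw : (freeTheoryLift η).app (ρ.app w) = w := congrArg (fun χ : Hom T T => χ.app w) hid
  obtain ⟨a, ha⟩ := exists_freeTheoryMk (ρ.app w)
  rw [← ha] at hw
  exact ⟨a.arity, a.label, a.word, hw⟩

/-- Relabelled words of the operad agree in the free theory only if they differ by a bijective
renumbering of the inputs. -/
theorem exists_bijective (hη : IsFreeTheoryOn η) {k k' n : ℕ} {f : Fin k → Fin n}
    {f' : Fin k' → Fin n} {c : C.word k} {c' : C.word k'}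
    (h : T.map f (.theory f) (η.app c) = T.map f' (.theory f') (η.app c')) :
    ∃ (σ : Fin k → Fin k') (hσ : Function.Bijective σ),
      (∀ x, f' (σ x) = f x) ∧ C.map σ hσ c = c' := by
  obtain ⟨ρ, hρ, -⟩ := hη _ C.freeTheoryUnit
  have key : ∀ {k : ℕ} (f : Fin k → Fin n) (c : C.word k),
      ρ.app (T.map f (.theory f) (η.app c)) = freeTheoryMk ⟨k, f, c⟩ := by
    intro k f c
    have h : ρ.app (η.app c) = C.freeTheoryUnit.app c :=
      congrArg (fun χ : Hom C C.freeTheory.toOperad => χ.app c) hρ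
    exact (ρ.app_map f (.theory f) _).trans <| (congrArg _ h).trans <| freeTheory_map f _ _
  have h' := congrArg ρ.app h
  rw [key, key] at h'
  exact freeTheoryMk_eq_iff.1 h'

theorem injective (hη : IsFreeTheoryOn η) {n : ℕ} :
    Function.Injective (η.app : C.word n → T.word n) := by
  intro c c' h
  obtain ⟨σ, hσ, hx, hc⟩ := hη.exists_bijective (f := fun x => x) (f' := fun x => x)
    (congrArg _ h)
  exact (C.map_eq_self hσ hx c).symm.trans hc

/-- A relabelled word of the operad lies in the operad only if the relabelling is bijective. -/
theorem bijective_of_map_eq (hη : IsFreeTheoryOn η) {k n : ℕ} {f : Fin k → Fin n} {c : C.word k}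
    {c' : C.word n} (h : T.map f (.theory f) (η.app c) = η.app c') : Function.Bijective f := by
  obtain ⟨σ, hσ, hx, -⟩ := hη.exists_bijective (f' := fun x => x) (h.trans (T.map_id _).symm)
  exact (funext hx : σ = f) ▸ hσ

end IsFreeTheoryOn

/-! ### Morphisms out of quotients and free categorical theories -/

theorem CatSystem.vcomp_congr {K : Kind} (E : CatSystem.{u} K) {n : ℕ} {p p' q q' : E.Mor.word n}
    (hp : p = p') (hq : q = q') (h h') : E.vcomp p q h = E.vcomp p' q' h' := by
  subst hp hq
  rfl

namespace PreCatSystem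

variable {K : Kind} {A : PreCatSystem.{u} K} {R : ∀ n, A.Mor n → A.Mor n → Prop}

/-- Morphisms from a system of arrows without laws to a categorical theory (or operad). -/
structure HomTo (A : PreCatSystem.{u} K) (E : CatSystem.{v} K) where
  ob : OpSystem.Hom A.Ob E.Ob
  mor : ∀ {n : ℕ}, A.Mor n → E.Mor.word n
  src_mor : ∀ {n : ℕ} (p : A.Mor n), E.src.app (mor p) = ob.app (A.src p)
  tgt_mor : ∀ {n : ℕ} (p : A.Mor n), E.tgt.app (mor p) = ob.app (A.tgt p)
  mor_idm : ∀ {n : ℕ} (a : A.Ob.word n), mor (A.idm a) = E.idm.app (ob.app a)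
  mor_vcomp : ∀ {n : ℕ} (p q : A.Mor n) (h h'),
    mor (A.vcomp p q h) = E.vcomp (mor p) (mor q) h'
  mor_map : ∀ {m n : ℕ} (f : Fin m → Fin n) (hf : K.Allowed f) (p : A.Mor m),
    mor (A.map f hf p) = E.Mor.map f hf (mor p)
  mor_comp : ∀ {k : ℕ} {n : Fin k → ℕ} (p : A.Mor k) (ps : ∀ i, A.Mor (n i)),
    mor (A.comp p ps) = E.Mor.comp (mor p) fun i => mor (ps i)

namespace HomTo

variable {E : CatSystem.{v} K} (φ : HomTo A E)

theorem composable {n : ℕ} {p q : A.Mor n} (h : A.tgt p = A.src q) :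
    E.tgt.app (φ.mor p) = E.src.app (φ.mor q) := by
  rw [φ.tgt_mor, φ.src_mor, h]

theorem mor_idm_one : φ.mor (A.idm A.Ob.one) = E.Mor.one := by
  rw [φ.mor_idm, φ.ob.app_one, E.idm.app_one]

theorem mor_eq_of_rel (hR : ∀ n (p q : A.Mor n), R n p q → A.src p = A.src q →
    A.tgt p = A.tgt q → φ.mor p = φ.mor q) {n : ℕ} {p q : A.Mor n} (h : Rel A R p q) :
    φ.mor p = φ.mor q := by
  induction h with
  | of h hs ht => exact hR _ _ _ h hs ht
  | refl => rfl
  | symm _ ih => exact ih.symm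
  | trans _ _ ih ih' => exact ih.trans ih'
  | vcomp h h' _ _ ih ih' =>
    rw [φ.mor_vcomp _ _ _ (φ.composable h), φ.mor_vcomp _ _ _ (φ.composable h')]
    exact E.vcomp_congr ih ih' _ _
  | map f hf _ ih => rw [φ.mor_map, φ.mor_map, ih]
  | comp _ _ ih ih' => rw [φ.mor_comp, φ.mor_comp, ih, funext ih']
  | id_vcomp p h =>
    rw [φ.mor_vcomp _ _ _ (φ.composable h)]
    exact (E.vcomp_congr ((φ.mor_idm _).trans (congrArg _ (φ.src_mor p).symm)) rfl _
      (E.tgt_idm _)).trans (E.id_vcomp _ _)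
  | vcomp_id p h =>
    rw [φ.mor_vcomp _ _ _ (φ.composable h)]
    exact (E.vcomp_congr rfl ((φ.mor_idm _).trans (congrArg _ (φ.tgt_mor p).symm)) _
      (E.src_idm _).symm).trans (E.vcomp_id _ _)
  | vcomp_assoc p q r h h' h₁ h₂ =>
    rw [φ.mor_vcomp _ _ _ (φ.composable h₁), φ.mor_vcomp _ _ _ (φ.composable h₂)]
    exact (E.vcomp_congr (φ.mor_vcomp _ _ _ (φ.composable h)) rfl _
      ((E.tgt_vcomp _ _ _).trans (φ.composable h'))).trans <|
        (E.vcomp_assoc _ _ _ _ (φ.composable h') _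
          ((φ.composable h).trans (E.src_vcomp _ _ _).symm)).trans <|
            E.vcomp_congr rfl (φ.mor_vcomp _ _ _ (φ.composable h')).symm _ _
  | idm_map f hf a => rw [φ.mor_idm, φ.mor_map, φ.mor_idm, φ.ob.app_map, E.idm.app_map]
  | idm_comp a as =>
    rw [φ.mor_idm, φ.mor_comp, φ.mor_idm, φ.ob.app_comp, E.idm.app_comp]
    simp only [φ.mor_idm]
  | vcomp_map f hf p q h h' =>
    rw [φ.mor_vcomp _ _ _ (φ.composable h'), φ.mor_map f hf (A.vcomp p q h),
      φ.mor_vcomp _ _ _ (φ.composable h)]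
    exact (E.vcomp_congr (φ.mor_map _ _ _) (φ.mor_map _ _ _) _ (by
      rw [← φ.mor_map, ← φ.mor_map]; exact φ.composable h')).trans (E.vcomp_map f hf _ _ _ _)
  | vcomp_comp p q ps qs h hs h' =>
    rw [φ.mor_vcomp _ _ _ (φ.composable h'), φ.mor_comp (A.vcomp p q h),
      φ.mor_vcomp _ _ _ (φ.composable h)]
    refine (E.vcomp_congr (φ.mor_comp _ _) (φ.mor_comp _ _) _ (by
      rw [← φ.mor_comp, ← φ.mor_comp]; exact φ.composable h')).trans ?_
    refine (E.vcomp_comp _ _ _ _ (φ.composable h) (fun i => φ.composable (hs i)) _).trans ?_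
    exact congrArg _ (funext fun i => (φ.mor_vcomp _ _ _ (φ.composable (hs i))).symm)
  | map_id p => rw [φ.mor_map, E.Mor.map_id]
  | map_map g hg f hf p => rw [φ.mor_map, φ.mor_map, φ.mor_map, E.Mor.map_map]
  | comp_assoc p ps qs =>
    rw [φ.mor_map, φ.mor_comp, φ.mor_comp, φ.mor_comp]
    simp only [φ.mor_comp]
    exact E.Mor.comp_assoc _ _ fun i j => φ.mor (qs i j)
  | comp_one p => rw [φ.mor_comp, φ.mor_map, φ.mor_idm_one, E.Mor.comp_one]
  | one_comp p => rw [φ.mor_comp, φ.mor_map, φ.mor_idm_one, E.Mor.one_comp]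
  | map_comp f hf p ps =>
    rw [φ.mor_comp, φ.mor_map, φ.mor_map, φ.mor_comp]
    exact E.Mor.map_comp f hf _ fun j => φ.mor (ps j)
  | comp_map g hg p ps =>
    rw [φ.mor_comp, φ.mor_map, φ.mor_comp]
    simp only [φ.mor_map]
    exact E.Mor.comp_map g hg _ fun j => φ.mor (ps j)

/-- The morphism from the quotient by `R` induced by a morphism that identifies `R`-related
arrows. -/
noncomputable def quotLift (hR : ∀ n (p q : A.Mor n), R n p q → A.src p = A.src q →
    A.tgt p = A.tgt q → φ.mor p = φ.mor q) : CatSystem.Hom (A.quot R) E :=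
  have h : ∀ {n : ℕ} (p : A.Mor n), φ.mor (A.cls R p).out = φ.mor p := fun p =>
    φ.mor_eq_of_rel hR (out_cls p)
  { ob := φ.ob
    mor :=
      { app := fun p => φ.mor p.out
        app_map := fun f hf _ => (h _).trans (φ.mor_map f hf _)
        app_one := (h _).trans φ.mor_idm_one
        app_comp := fun _ _ => (h _).trans (φ.mor_comp _ _) }
    src_mor := fun _ => φ.src_mor _
    tgt_mor := fun _ => φ.tgt_mor _
    mor_idm := fun a => (h _).trans (φ.mor_idm a)
    mor_vcomp := fun _ _ e e' => (h _).trans (φ.mor_vcomp _ _ e e') }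

theorem quotLift_cls (hR : ∀ n (p q : A.Mor n), R n p q → A.src p = A.src q →
    A.tgt p = A.tgt q → φ.mor p = φ.mor q) {n : ℕ} (p : A.Mor n) :
    (φ.quotLift hR).mor.app (A.cls R p) = φ.mor p :=
  φ.mor_eq_of_rel hR (out_cls p)

end HomTo

theorem quot_vcomp_cls {n : ℕ} (p q : A.Mor n) (h h') :
    (A.quot R).vcomp (A.cls R p) (A.cls R q) h' = A.cls R (A.vcomp p q h) :=
  cls_eq (.vcomp _ _ (out_cls p) (out_cls q))

theorem quot_map_cls {m n : ℕ} (f : Fin m → Fin n) (hf : K.Allowed f) (p : A.Mor m) :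
    (A.quot R).Mor.map f hf (A.cls R p) = A.cls R (A.map f hf p) :=
  cls_eq (.map f hf (out_cls p))

theorem quot_comp_cls {k : ℕ} {n : Fin k → ℕ} (p : A.Mor k) (ps : ∀ i, A.Mor (n i)) :
    (A.quot R).Mor.comp (A.cls R p) (fun i => A.cls R (ps i)) = A.cls R (A.comp p ps) :=
  cls_eq (.comp (out_cls p) fun i => out_cls (ps i))

end PreCatSystem

namespace CatSystem

variable {K : Kind} {A : CatSystem.{u} K} {E : CatSystem.{v} K}

/-- A morphism of categorical theories (or operads), with the laws of its source forgotten. -/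
def Hom.toPre (φ : Hom A E) : PreCatSystem.HomTo A.toPre E where
  ob := φ.ob
  mor := φ.mor.app
  src_mor := φ.src_mor
  tgt_mor := φ.tgt_mor
  mor_idm := φ.mor_idm
  mor_vcomp := φ.mor_vcomp
  mor_map := φ.mor.app_map
  mor_comp := φ.mor.app_comp

/-- The projection from a categorical theory (or operad) to its quotient. -/
noncomputable def quotProj (A : CatSystem.{u} K) (R : ∀ n, A.Mor.word n → A.Mor.word n → Prop) :
    Hom A (A.quot R) where
  ob := .id _
  mor :=
    { app := A.toPre.cls R
      app_map := fun f hf p => (PreCatSystem.quot_map_cls (A := A.toPre) f hf p).symm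
      app_one := congrArg (A.toPre.cls R) A.idm.app_one.symm
      app_comp := fun p ps => (PreCatSystem.quot_comp_cls (A := A.toPre) p ps).symm }
  src_mor p := PreCatSystem.src_out (A := A.toPre) p
  tgt_mor p := PreCatSystem.tgt_out (A := A.toPre) p
  mor_idm _ := rfl
  mor_vcomp p q h h' := (PreCatSystem.quot_vcomp_cls (A := A.toPre) p q h h').symm

theorem quotProj_surjective {R : ∀ n, A.Mor.word n → A.Mor.word n → Prop} {n : ℕ}
    (p : (A.quot R).Mor.word n) : ∃ q : A.Mor.word n, (A.quotProj R).mor.app q = p :=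
  ⟨p.out, PreCatSystem.cls_out (A := A.toPre) p⟩

theorem Hom.eq_of_app_eq {φ ψ : Hom A E}
    (hob : ∀ (n : ℕ) (a : A.Ob.word n), φ.ob.app a = ψ.ob.app a)
    (hmor : ∀ (n : ℕ) (p : A.Mor.word n), φ.mor.app p = ψ.mor.app p) : φ = ψ :=
  Hom.ext (OpSystem.Hom.ext (funext fun _ => funext (hob _)))
    (OpSystem.Hom.ext (funext fun _ => funext (hmor _)))

end CatSystem

namespace GraphicalPreSystem

variable {K : Kind} {G : GraphicalPreSystem.{u} K} {E : CatSystem.{v} K}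

/-- The value in `E` of a formal arrow, given values of the objects and of the arrows of `G`. -/
def Term.eval (ob : OpSystem.Hom G.Ob E.Ob) (arr : ∀ {n : ℕ}, G.Mor n → E.Mor.word n)
    (hs : ∀ {n : ℕ} (e : G.Mor n), E.src.app (arr e) = ob.app (G.src e))
    (ht : ∀ {n : ℕ} (e : G.Mor n), E.tgt.app (arr e) = ob.app (G.tgt e)) :
    ∀ {n : ℕ} {a b : G.Ob.word n}, G.Term n a b →
      { p : E.Mor.word n // E.src.app p = ob.app a ∧ E.tgt.app p = ob.app b }
  | _, _, _, .arrow e => ⟨arr e, hs e, ht e⟩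
  | _, _, _, .idm a => ⟨E.idm.app (ob.app a), E.src_idm _, E.tgt_idm _⟩
  | _, _, _, .vcomp s h t =>
    let p := eval ob arr hs ht s
    let q := eval ob arr hs ht t
    ⟨E.vcomp p.1 q.1 (p.2.2.trans ((congrArg ob.app h).trans q.2.1.symm)),
      (E.src_vcomp _ _ _).trans p.2.1, (E.tgt_vcomp _ _ _).trans q.2.2⟩
  | _, _, _, .map f hf t =>
    let p := eval ob arr hs ht t
    ⟨E.Mor.map f hf p.1,
      (E.src.app_map f hf _).trans ((congrArg _ p.2.1).trans (ob.app_map f hf _).symm),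
      (E.tgt.app_map f hf _).trans ((congrArg _ p.2.2).trans (ob.app_map f hf _).symm)⟩
  | _, _, _, .comp t ts =>
    let p := eval ob arr hs ht t
    let ps := fun i => eval ob arr hs ht (ts i)
    ⟨E.Mor.comp p.1 fun i => (ps i).1,
      (E.src.app_comp _ _).trans
        ((congrArg₂ _ p.2.1 (funext fun i => (ps i).2.1)).trans (ob.app_comp _ _).symm),
      (E.tgt.app_comp _ _).trans
        ((congrArg₂ _ p.2.2 (funext fun i => (ps i).2.2)).trans (ob.app_comp _ _).symm)⟩

/-- Evaluation of formal arrows as a morphism. -/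
def evalHom (ob : OpSystem.Hom G.Ob E.Ob) (arr : ∀ {n : ℕ}, G.Mor n → E.Mor.word n)
    (hs : ∀ {n : ℕ} (e : G.Mor n), E.src.app (arr e) = ob.app (G.src e))
    (ht : ∀ {n : ℕ} (e : G.Mor n), E.tgt.app (arr e) = ob.app (G.tgt e)) :
    PreCatSystem.HomTo G.termSystem E where
  ob := ob
  mor t := (Term.eval ob arr hs ht t.2.2).1
  src_mor t := (Term.eval ob arr hs ht t.2.2).2.1
  tgt_mor t := (Term.eval ob arr hs ht t.2.2).2.2
  mor_idm _ := rfl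
  mor_vcomp _ _ _ _ := rfl
  mor_map _ _ _ := rfl
  mor_comp _ _ := rfl

/-- The morphism from the free categorical theory on `G` given by values of the objects and of the
arrows of `G` that respect source, target and identities. -/
noncomputable def freeLift (ob : OpSystem.Hom G.Ob E.Ob)
    (arr : ∀ {n : ℕ}, G.Mor n → E.Mor.word n)
    (hs : ∀ {n : ℕ} (e : G.Mor n), E.src.app (arr e) = ob.app (G.src e))
    (ht : ∀ {n : ℕ} (e : G.Mor n), E.tgt.app (arr e) = ob.app (G.tgt e))
    (hid : ∀ {n : ℕ} (a : G.Ob.word n), arr (G.idm a) = E.idm.app (ob.app a)) :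
    CatSystem.Hom G.free E :=
  (evalHom ob arr hs ht).quotLift (R := G.IdRel) (by
    rintro n _ _ ⟨a⟩ - -
    exact hid a)

theorem freeLift_arrow (ob : OpSystem.Hom G.Ob E.Ob)
    (arr : ∀ {n : ℕ}, G.Mor n → E.Mor.word n)
    (hs : ∀ {n : ℕ} (e : G.Mor n), E.src.app (arr e) = ob.app (G.src e))
    (ht : ∀ {n : ℕ} (e : G.Mor n), E.tgt.app (arr e) = ob.app (G.tgt e))
    (hid : ∀ {n : ℕ} (a : G.Ob.word n), arr (G.idm a) = E.idm.app (ob.app a)) {n : ℕ}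
    (e : G.Mor n) : (freeLift ob arr hs ht hid).mor.app (G.arrow e) = arr e :=
  (evalHom ob arr hs ht).quotLift_cls _ ⟨_, _, .arrow e⟩

theorem src_arrow {n : ℕ} (e : G.Mor n) : G.free.src.app (G.arrow e) = G.src e :=
  PreCatSystem.src_out (A := G.termSystem) (R := G.IdRel) ⟨_, _, .arrow e⟩

theorem tgt_arrow {n : ℕ} (e : G.Mor n) : G.free.tgt.app (G.arrow e) = G.tgt e :=
  PreCatSystem.tgt_out (A := G.termSystem) (R := G.IdRel) ⟨_, _, .arrow e⟩

theorem arrow_idm {n : ℕ} (a : G.Ob.word n) : G.arrow (G.idm a) = G.free.idm.app a :=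
  PreCatSystem.cls_eq (.of (.idm a) (G.src_idm a) (G.tgt_idm a))

/-- The arrows of the free categorical theory on `G` are built from those of `G` by the operations
of a categorical theory. -/
theorem free_induction {P : ∀ {n : ℕ}, G.free.Mor.word n → Prop}
    (arrow : ∀ {n : ℕ} (e : G.Mor n), P (G.arrow e))
    (idm : ∀ {n : ℕ} (a : G.Ob.word n), P (G.free.idm.app a))
    (vcomp : ∀ {n : ℕ} (p q : G.free.Mor.word n) (h), P p → P q → P (G.free.vcomp p q h))
    (map : ∀ {m n : ℕ} (f : Fin m → Fin n) (hf : K.Allowed f) (p : G.free.Mor.word m),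
      P p → P (G.free.Mor.map f hf p))
    (comp : ∀ {k : ℕ} {n : Fin k → ℕ} (p : G.free.Mor.word k) (ps : ∀ i, G.free.Mor.word (n i)),
      P p → (∀ i, P (ps i)) → P (G.free.Mor.comp p ps))
    {n : ℕ} (p : G.free.Mor.word n) : P p := by
  have key : ∀ {n : ℕ} {a b : G.Ob.word n} (t : G.Term n a b),
      P (n := n) (G.termSystem.cls G.IdRel ⟨a, b, t⟩) := by
    intro n a b t
    induction t with
    | arrow e => exact arrow e
    | idm a => exact idm a
    | @vcomp n a b b' c s h t ihs iht =>
      have e := PreCatSystem.quot_vcomp_cls (A := G.termSystem) (R := G.IdRel)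
        ⟨a, b, s⟩ ⟨b', c, t⟩ h
        ((PreCatSystem.tgt_out (A := G.termSystem) (R := G.IdRel) ⟨a, b, s⟩).trans
          (h.trans (PreCatSystem.src_out (A := G.termSystem) (R := G.IdRel) ⟨b', c, t⟩).symm))
      exact e ▸ vcomp _ _ _ ihs iht
    | map f hf t ih =>
      have e := PreCatSystem.quot_map_cls (A := G.termSystem) (R := G.IdRel) f hf ⟨_, _, t⟩
      exact e ▸ map f hf _ ih
    | comp t ts ih ihs =>
      have e := PreCatSystem.quot_comp_cls (A := G.termSystem) (R := G.IdRel) ⟨_, _, t⟩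
        fun i => ⟨_, _, ts i⟩
      exact e ▸ comp _ _ ih ihs
  exact PreCatSystem.cls_out (A := G.termSystem) p ▸ key _

theorem free_hom_ext {φ ψ : CatSystem.Hom G.free E}
    (hob : ∀ (n : ℕ) (a : G.Ob.word n), φ.ob.app a = ψ.ob.app a)
    (hmor : ∀ (n : ℕ) (e : G.Mor n), φ.mor.app (G.arrow e) = ψ.mor.app (G.arrow e)) : φ = ψ := by
  refine CatSystem.Hom.eq_of_app_eq hob fun n p => ?_
  induction p using free_induction with
  | arrow e => exact hmor _ e
  | idm a => exact (φ.mor_idm a).trans ((congrArg _ (hob _ a)).trans (ψ.mor_idm a).symm)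
  | vcomp p q h hp hq =>
    have hφ : E.tgt.app (φ.mor.app p) = E.src.app (φ.mor.app q) := by
      rw [φ.tgt_mor, φ.src_mor, h]
    have hψ : E.tgt.app (ψ.mor.app p) = E.src.app (ψ.mor.app q) := by
      rw [ψ.tgt_mor, ψ.src_mor, h]
    exact (φ.mor_vcomp p q h hφ).trans <|
      (E.vcomp_congr hp hq hφ hψ).trans (ψ.mor_vcomp p q h hψ).symm
  | map f hf p ih => rw [φ.mor.app_map, ψ.mor.app_map, ih]
  | comp p ps ih ihs => rw [φ.mor.app_comp, ψ.mor.app_comp, ih, funext ihs]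

end GraphicalPreSystem

/-! ### The objects: free operads and free theories on the same generators -/

namespace OpSystem

theorem free.app_eq_of_gen {K : Kind} {Z : ℕ → Type u} {A : OpSystem.{v} K}
    {φ ψ : Hom (free K Z) A} (h : ∀ (n : ℕ) (z : Z n), φ.app (free.gen z) = ψ.app (free.gen z))
    {n : ℕ} (w : (free K Z).word n) : φ.app w = ψ.app w := by
  have hcomp : ∀ {k : ℕ} {n : Fin k → ℕ} (t : FreeTerm K Z k) (ts : ∀ i, FreeTerm K Z (n i)),
      (Quotient.mk (FreeTerm.setoid K Z _) (t.comp ts) : (free K Z).word _) =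
        (free K Z).comp (Quotient.mk (FreeTerm.setoid K Z k) t)
          fun i => Quotient.mk (FreeTerm.setoid K Z (n i)) (ts i) := fun t ts =>
    Quotient.sound (FreeTerm.Rel.comp (out_rel t).symm fun i => (out_rel (ts i)).symm)
  obtain ⟨t, rfl⟩ := Quotient.exists_rep (s := FreeTerm.setoid K Z n) w
  induction t with
  | gen z => exact h _ z
  | one => exact φ.app_one.trans ψ.app_one.symm
  | map f hf t ih =>
    exact (φ.app_map f hf _).trans ((congrArg _ ih).trans (ψ.app_map f hf _).symm)
  | comp t ts ih ihs =>
    rw [hcomp]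
    exact (φ.app_comp _ _).trans ((congrArg₂ _ ih (funext ihs)).trans (ψ.app_comp _ _).symm)

namespace Hom

variable {C : Operad.{u}} {T : Theory.{u}} (η : Hom C T.toOperad)

/-- The morphism from the free operad on `C(n)` to the free theory on `S(n) = η(C(n))` given by
`η` on the generators. -/
noncomputable def laplazaOb : Hom C.opWords η.laplazaSet.words.toOperad :=
  free.lift (A := η.laplazaSet.words.toOperad) fun _ c => η.laplazaGen c

theorem proj_laplazaOb {n : ℕ} (t : C.opWords.word n) :
    η.laplazaSet.proj.app (η.laplazaOb.app t) = η.app (C.opProj.app t) :=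
  free.app_eq_of_gen (φ := η.laplazaSet.proj.toOperad.comp η.laplazaOb) (ψ := η.comp C.opProj)
    (fun _ _ => rfl) t

theorem app_eq_of_laplazaOb {E : Theory.{v}} {ψ ψ' : Hom η.laplazaSet.words E}
    (h : ∀ (n : ℕ) (t : C.opWords.word n),
      ψ.app (η.laplazaOb.app t) = ψ'.app (η.laplazaOb.app t))
    {n : ℕ} (a : η.laplazaSet.words.word n) : ψ.app a = ψ'.app a := by
  refine free.app_eq_of_gen ?_ a
  rintro n ⟨_, c, rfl⟩
  exact h n (free.gen c)

variable {η}

theorem exists_laplazaOb_extension (hη : IsFreeTheoryOn η) {E : Theory.{v}}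
    (φ : Hom C.opWords E.toOperad) :
    ∃ ψ : Hom η.laplazaSet.words E, ∀ (n : ℕ) (t : C.opWords.word n),
      ψ.app (η.laplazaOb.app t) = φ.app t := by
  let ψ : Hom η.laplazaSet.words E :=
    free.lift fun n (s : η.laplazaSet n) => φ.app (free.gen s.2.choose)
  refine ⟨ψ, fun n t => ?_⟩
  refine free.app_eq_of_gen (φ := ψ.toOperad.comp η.laplazaOb) (ψ := φ) (fun n c => ?_) t
  have h : ∃ c', η.app c' = η.app c := ⟨c, rfl⟩
  exact congrArg (fun c => φ.app (free.gen c)) (hη.injective h.choose_spec)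

theorem isFreeTheoryOn_laplazaOb (hη : IsFreeTheoryOn η) : IsFreeTheoryOn η.laplazaOb := by
  intro E φ
  obtain ⟨ψ, hψ⟩ := exists_laplazaOb_extension hη φ
  refine ⟨ψ, Hom.ext (funext fun n => funext fun t => hψ n t), fun ψ' h => ?_⟩
  refine Hom.ext (funext fun n => funext fun a => app_eq_of_laplazaOb η (fun n t => ?_) a)
  exact (congrArg (fun χ : Hom C.opWords E.toOperad => χ.app t) h).trans (hψ n t).symm

theorem laplazaOb_injective (hη : IsFreeTheoryOn η) {n : ℕ} :
    Function.Injective (η.laplazaOb.app : C.opWords.word n → _) :=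
  (isFreeTheoryOn_laplazaOb hη).injective

/-- If a relabelled word of the free operad projects to `S`, then the relabelling is bijective. -/
theorem bijective_of_proj_mem (hη : IsFreeTheoryOn η) {k n : ℕ} {f : Fin k → Fin n}
    {t : C.opWords.word k}
    (h : η.laplazaSet.proj.app (η.laplazaSet.words.map f (.theory f) (η.laplazaOb.app t)) ∈
      η.laplazaSet n) : Function.Bijective f := by
  obtain ⟨c, hc⟩ := h
  refine hη.bijective_of_map_eq (c := C.opProj.app t) (c' := c) ?_
  refine Eq.trans ?_ hc.symm
  exact (congrArg (T.map f (.theory f)) (proj_laplazaOb η t).symm).trans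
    (η.laplazaSet.proj.app_map f (.theory f) _).symm

theorem exists_laplazaOb_eq (hη : IsFreeTheoryOn η) {n : ℕ} {a : η.laplazaSet.words.word n}
    (h : η.laplazaSet.proj.app a ∈ η.laplazaSet n) :
    ∃ t : C.opWords.word n, η.laplazaOb.app t = a := by
  obtain ⟨k, f, t, rfl⟩ := (isFreeTheoryOn_laplazaOb hη).exists_map_eq a
  exact ⟨C.opWords.map f (bijective_of_proj_mem hη h) t, η.laplazaOb.app_map _ _ t⟩

theorem coherent_laplazaOb {n : ℕ} {t t' : C.opWords.word n}
    (h : C.opProj.app t = C.opProj.app t') :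
    η.laplazaSet.Coherent (η.laplazaOb.app t) (η.laplazaOb.app t') :=
  ⟨(proj_laplazaOb η t).trans ((congrArg η.app h).trans (proj_laplazaOb η t').symm),
    C.opProj.app t, (proj_laplazaOb η t).symm⟩

/-- Coherent objects of `T'_S` are the images of objects of `C'` that are joined by an arrow. -/
theorem exists_arrow_of_coherent (hη : IsFreeTheoryOn η) {n : ℕ}
    {a b : η.laplazaSet.words.word n} (h : η.laplazaSet.Coherent a b) :
    ∃ e : C.pseudo.Mor.word n,
      η.laplazaOb.app (C.pseudo.src.app e) = a ∧ η.laplazaOb.app (C.pseudo.tgt.app e) = b := by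
  obtain ⟨t, rfl⟩ := exists_laplazaOb_eq hη h.2
  obtain ⟨t', rfl⟩ := exists_laplazaOb_eq hη (h.1 ▸ h.2)
  refine ⟨⟨(t, t'), hη.injective ?_⟩, rfl, rfl⟩
  exact (proj_laplazaOb η t).symm.trans (h.1.trans (proj_laplazaOb η t'))

end Hom

theorem pseudo_mor_ext {C : Operad.{u}} {n : ℕ} {e e' : C.pseudo.Mor.word n}
    (hs : C.pseudo.src.app e = C.pseudo.src.app e')
    (ht : C.pseudo.tgt.app e = C.pseudo.tgt.app e') : e = e' :=
  Subtype.ext (Prod.ext hs ht)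

end OpSystem

namespace LaplazaSet

variable {T : Theory.{u}} {S : LaplazaSet T}

theorem pseudo_mor_ext {n : ℕ} {α β : S.pseudo.Mor.word n}
    (hs : S.pseudo.src.app α = S.pseudo.src.app β) (ht : S.pseudo.tgt.app α = S.pseudo.tgt.app β)
    (h : S.Coherent (S.pseudo.src.app α) (S.pseudo.tgt.app α)) : α = β := by
  have hrel : S.graph.free.toPre.Rel S.CohRel α.out β.out := .of (.coh _ _ hs ht h) hs ht
  have e := PreCatSystem.cls_eq (A := S.graph.free.toPre) hrel
  exact (PreCatSystem.cls_out α).symm.trans (e.trans (PreCatSystem.cls_out β))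

/-- The arrow `ι_{a,b}` of `T'_S`. -/
noncomputable def pseudoIota {n : ℕ} (a b : S.words.word n) (h : S.Coherent a b) :
    S.pseudo.Mor.word n :=
  (S.graph.free.quotProj S.CohRel).mor.app (S.iota a b h)

theorem src_pseudoIota {n : ℕ} {a b : S.words.word n} (h : S.Coherent a b) :
    S.pseudo.src.app (pseudoIota a b h) = a :=
  ((S.graph.free.quotProj S.CohRel).src_mor _).trans (S.graph.src_arrow _)

theorem tgt_pseudoIota {n : ℕ} {a b : S.words.word n} (h : S.Coherent a b) :
    S.pseudo.tgt.app (pseudoIota a b h) = b :=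
  ((S.graph.free.quotProj S.CohRel).tgt_mor _).trans (S.graph.tgt_arrow _)

theorem eq_pseudoIota {n : ℕ} {a b : S.words.word n} (h : S.Coherent a b)
    {α : S.pseudo.Mor.word n} (hs : S.pseudo.src.app α = a) (ht : S.pseudo.tgt.app α = b) :
    α = pseudoIota a b h := by
  subst hs ht
  exact pseudo_mor_ext (src_pseudoIota h).symm (tgt_pseudoIota h).symm h

end LaplazaSet

/-! ### The comparison morphism -/

namespace OpSystem.Hom

open LaplazaSet

variable {C : Operad.{u}} {T : Theory.{u}} (η : Hom C T.toOperad)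

/-- The arrow of `T'_S` that corresponds to an arrow of `C'`. -/
noncomputable def comparisonMor {n : ℕ} (e : C.pseudo.Mor.word n) :
    η.laplazaSet.pseudo.Mor.word n :=
  pseudoIota (η.laplazaOb.app (C.pseudo.src.app e)) (η.laplazaOb.app (C.pseudo.tgt.app e))
    (coherent_laplazaOb e.2)

theorem eq_comparisonMor {n : ℕ} {e : C.pseudo.Mor.word n} {α : η.laplazaSet.pseudo.Mor.word n}
    (hs : η.laplazaSet.pseudo.src.app α = η.laplazaOb.app (C.pseudo.src.app e))
    (ht : η.laplazaSet.pseudo.tgt.app α = η.laplazaOb.app (C.pseudo.tgt.app e)) :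
    α = η.comparisonMor e :=
  eq_pseudoIota _ hs ht

theorem src_comparisonMor {n : ℕ} (e : C.pseudo.Mor.word n) :
    η.laplazaSet.pseudo.src.app (η.comparisonMor e) = η.laplazaOb.app (C.pseudo.src.app e) :=
  src_pseudoIota _

theorem tgt_comparisonMor {n : ℕ} (e : C.pseudo.Mor.word n) :
    η.laplazaSet.pseudo.tgt.app (η.comparisonMor e) = η.laplazaOb.app (C.pseudo.tgt.app e) :=
  tgt_pseudoIota _

/-- The morphism `κ : C' → T'_S`. -/
noncomputable def comparison : CatSystem.Hom C.pseudo η.laplazaSet.pseudo.toOperad where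
  ob := η.laplazaOb
  mor :=
    { app := η.comparisonMor
      app_map := fun f hf e => .symm <| η.eq_comparisonMor
        ((η.laplazaSet.pseudo.src.app_map f (.theory f) _).trans <|
          (congrArg _ (η.src_comparisonMor e)).trans (η.laplazaOb.app_map f hf _).symm)
        ((η.laplazaSet.pseudo.tgt.app_map f (.theory f) _).trans <|
          (congrArg _ (η.tgt_comparisonMor e)).trans (η.laplazaOb.app_map f hf _).symm)
      app_one := .symm <| η.eq_comparisonMor
        (η.laplazaSet.pseudo.src.app_one.trans η.laplazaOb.app_one.symm)
        (η.laplazaSet.pseudo.tgt.app_one.trans η.laplazaOb.app_one.symm)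
      app_comp := fun e es => .symm <| η.eq_comparisonMor
        ((η.laplazaSet.pseudo.src.app_comp _ _).trans <|
          (congrArg₂ _ (η.src_comparisonMor e) (funext fun i => η.src_comparisonMor (es i))).trans
            (η.laplazaOb.app_comp _ _).symm)
        ((η.laplazaSet.pseudo.tgt.app_comp _ _).trans <|
          (congrArg₂ _ (η.tgt_comparisonMor e) (funext fun i => η.tgt_comparisonMor (es i))).trans
            (η.laplazaOb.app_comp _ _).symm) }
  src_mor := η.src_comparisonMor
  tgt_mor := η.tgt_comparisonMor
  mor_idm _ := .symm <| η.eq_comparisonMor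
    (η.laplazaSet.pseudo.src_idm _) (η.laplazaSet.pseudo.tgt_idm _)
  mor_vcomp e e' _ h' := .symm <| η.eq_comparisonMor
    ((η.laplazaSet.pseudo.src_vcomp _ _ h').trans (η.src_comparisonMor e))
    ((η.laplazaSet.pseudo.tgt_vcomp _ _ h').trans (η.tgt_comparisonMor e'))

theorem eq_comparison {κ : CatSystem.Hom C.pseudo η.laplazaSet.pseudo.toOperad}
    (h : ∀ (n : ℕ) (c : C.word n), κ.ob.app (free.gen c) = η.laplazaGen c) :
    κ = η.comparison := by
  have hob : ∀ {n : ℕ} (t : C.opWords.word n), κ.ob.app t = η.laplazaOb.app t := fun t =>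
    free.app_eq_of_gen (φ := κ.ob) (ψ := η.laplazaOb) h t
  refine CatSystem.Hom.eq_of_app_eq (fun n t => hob t) fun n e => ?_
  exact η.eq_comparisonMor ((κ.src_mor e).trans (hob _)) ((κ.tgt_mor e).trans (hob _))

end OpSystem.Hom

/-! ### Extension of morphisms along the comparison -/

section Extension

open OpSystem OpSystem.Hom LaplazaSet

variable {C : Operad.{u}} {T : Theory.{u}} {η : Hom C T.toOperad} {E : CatTheory.{v}}
  {φ : CatSystem.Hom C.pseudo E.toOperad}

/-- Up to a relabelling of the inputs, `p` is the image under `φ` of an arrow `e` of `C'`, and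
`a` and `b` are the images in the free theory on `S` of the source and the target of `e`. The arrow
`e` need not be determined by `a` and `b`: the relabelling may identify inputs. -/
def OpSystem.Hom.Lifts (η : Hom C T.toOperad) (φ : CatSystem.Hom C.pseudo E.toOperad) {n : ℕ}
    (a b : η.laplazaSet.words.word n) (p : E.Mor.word n) : Prop :=
  ∃ (k : ℕ) (f : Fin k → Fin n) (e : C.pseudo.Mor.word k),
    η.laplazaSet.words.map f (.theory f) (η.laplazaOb.app (C.pseudo.src.app e)) = a ∧
    η.laplazaSet.words.map f (.theory f) (η.laplazaOb.app (C.pseudo.tgt.app e)) = b ∧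
    E.Mor.map f (.theory f) (φ.mor.app e) = p

namespace OpSystem.Hom.Lifts

theorem of_eq {n : ℕ} {a a' b b' : η.laplazaSet.words.word n} {p p' : E.Mor.word n}
    (h : η.Lifts φ a b p) (ha : a = a') (hb : b = b') (hp : p = p') : η.Lifts φ a' b' p' :=
  ha ▸ hb ▸ hp ▸ h

theorem of_arrow {n : ℕ} (e : C.pseudo.Mor.word n) :
    η.Lifts φ (η.laplazaOb.app (C.pseudo.src.app e)) (η.laplazaOb.app (C.pseudo.tgt.app e))
      (φ.mor.app e) :=
  ⟨n, fun x => x, e, η.laplazaSet.words.map_id _, η.laplazaSet.words.map_id _, E.Mor.map_id _⟩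

theorem map {m n : ℕ} (f : Fin m → Fin n) {a b : η.laplazaSet.words.word m} {p : E.Mor.word m}
    (h : η.Lifts φ a b p) :
    η.Lifts φ (η.laplazaSet.words.map f (.theory f) a) (η.laplazaSet.words.map f (.theory f) b)
      (E.Mor.map f (.theory f) p) := by
  obtain ⟨k, g, e, rfl, rfl, rfl⟩ := h
  exact ⟨k, fun x => f (g x), e, (η.laplazaSet.words.map_map f (.theory f) g (.theory g) _).symm,
    (η.laplazaSet.words.map_map f (.theory f) g (.theory g) _).symm,
    (E.Mor.map_map f (.theory f) g (.theory g) _).symm⟩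

theorem idm (hη : IsFreeTheoryOn η) {ψ : Hom η.laplazaSet.words E.Ob}
    (hψ : ∀ (n : ℕ) (t : C.opWords.word n), ψ.app (η.laplazaOb.app t) = φ.ob.app t) {n : ℕ}
    (a : η.laplazaSet.words.word n) : η.Lifts φ a a (E.idm.app (ψ.app a)) := by
  obtain ⟨k, f, t, rfl⟩ := (isFreeTheoryOn_laplazaOb hη).exists_map_eq a
  refine ⟨k, f, C.pseudo.idm.app t, rfl, rfl, ?_⟩
  have h : φ.mor.app (C.pseudo.idm.app t) = E.idm.app (ψ.app (η.laplazaOb.app t)) :=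
    (φ.mor_idm t).trans (congrArg E.idm.app (hψ k t).symm)
  exact (congrArg (E.Mor.map f (.theory f)) h).trans <|
    (E.idm.app_map f (.theory f) _).symm.trans <|
      congrArg E.idm.app (ψ.app_map f (.theory f) _).symm

theorem comp {l : ℕ} {n : Fin l → ℕ} {a b : η.laplazaSet.words.word l} {p : E.Mor.word l}
    {as bs : ∀ j, η.laplazaSet.words.word (n j)} {ps : ∀ j, E.Mor.word (n j)}
    (h : η.Lifts φ a b p) (hs : ∀ j, η.Lifts φ (as j) (bs j) (ps j)) :
    η.Lifts φ (η.laplazaSet.words.comp a as) (η.laplazaSet.words.comp b bs)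
      (E.Mor.comp p ps) := by
  obtain ⟨k, f, e, rfl, rfl, rfl⟩ := h
  choose m g es has hbs hps using hs
  obtain rfl := funext has
  obtain rfl := funext hbs
  obtain rfl := funext hps
  refine ⟨_, fun y => blockMap f n (blockSum (fun i => g (f i)) y),
    C.pseudo.Mor.comp e fun i => es (f i), ?_, ?_, ?_⟩
  · refine Eq.trans ?_ (comp_map_map η.laplazaSet.words f g _ _)
    exact congrArg _ ((congrArg η.laplazaOb.app (C.pseudo.src.app_comp _ _)).trans
      (η.laplazaOb.app_comp _ _))
  · refine Eq.trans ?_ (comp_map_map η.laplazaSet.words f g _ _)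
    exact congrArg _ ((congrArg η.laplazaOb.app (C.pseudo.tgt.app_comp _ _)).trans
      (η.laplazaOb.app_comp _ _))
  · exact (congrArg _ (φ.mor.app_comp _ _)).trans
      (comp_map_map E.Mor f g (φ.mor.app e) fun j => φ.mor.app (es j))

theorem vcomp (hη : IsFreeTheoryOn η) {n : ℕ} {a b c : η.laplazaSet.words.word n}
    {p q : E.Mor.word n} (h : η.Lifts φ a b p) (h' : η.Lifts φ b c q)
    (hpq : E.tgt.app p = E.src.app q) : η.Lifts φ a c (E.vcomp p q hpq) := by
  obtain ⟨k, f, e, rfl, hb, rfl⟩ := h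
  obtain ⟨k', g, e', hb', rfl, rfl⟩ := h'
  -- The two presentations of the middle object differ by a bijection of the inputs, along which
  -- the first arrow is transported.
  obtain ⟨σ, hσ, hfg, ht⟩ :=
    (isFreeTheoryOn_laplazaOb hη).exists_bijective (hb.trans hb'.symm)
  obtain rfl : f = fun x => g (σ x) := funext fun x => (hfg x).symm
  have he : C.pseudo.tgt.app (C.pseudo.Mor.map σ hσ e) = C.pseudo.src.app e' :=
    (C.pseudo.tgt.app_map σ hσ e).trans ht
  have hφ : E.tgt.app (φ.mor.app (C.pseudo.Mor.map σ hσ e)) = E.src.app (φ.mor.app e') :=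
    (φ.tgt_mor _).trans ((congrArg φ.ob.app he).trans (φ.src_mor e').symm)
  have hmap : E.Mor.map g (.theory g) (φ.mor.app (C.pseudo.Mor.map σ hσ e)) =
      E.Mor.map (fun x => g (σ x)) (.theory _) (φ.mor.app e) :=
    (congrArg (E.Mor.map g (.theory g)) (φ.mor.app_map σ hσ e)).trans
      (E.Mor.map_map g (.theory g) σ (.theory σ) _)
  refine ⟨k', g, C.pseudo.vcomp (C.pseudo.Mor.map σ hσ e) e' he, ?_, ?_, ?_⟩
  · refine (congrArg (η.laplazaSet.words.map g (.theory g)) ((congrArg η.laplazaOb.app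
      ((C.pseudo.src_vcomp _ _ he).trans (C.pseudo.src.app_map σ hσ e))).trans
        (η.laplazaOb.app_map σ hσ _))).trans ?_
    exact η.laplazaSet.words.map_map g (.theory g) σ (.theory σ) _
  · exact congrArg (η.laplazaSet.words.map g (.theory g))
      (congrArg η.laplazaOb.app (C.pseudo.tgt_vcomp _ _ he))
  · refine (congrArg (E.Mor.map g (.theory g)) (φ.mor_vcomp _ _ he hφ)).trans ?_
    have hg : E.tgt.app (E.Mor.map g (.theory g) (φ.mor.app (C.pseudo.Mor.map σ hσ e))) =
        E.src.app (E.Mor.map g (.theory g) (φ.mor.app e')) :=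
      (congrArg E.tgt.app hmap).trans hpq
    exact (E.vcomp_map g (.theory g) _ _ hφ hg).symm.trans (E.vcomp_congr hmap rfl _ _)

/-- Over coherent objects relabellings are bijective, so that the arrow is determined by its
source and target. -/
theorem unique (hη : IsFreeTheoryOn η) {n : ℕ} {a b : η.laplazaSet.words.word n}
    {p q : E.Mor.word n} (hab : η.laplazaSet.Coherent a b) (h : η.Lifts φ a b p)
    (h' : η.Lifts φ a b q) : p = q := by
  have key : ∀ {p : E.Mor.word n}, η.Lifts φ a b p → ∃ e : C.pseudo.Mor.word n,
      η.laplazaOb.app (C.pseudo.src.app e) = a ∧ η.laplazaOb.app (C.pseudo.tgt.app e) = b ∧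
        φ.mor.app e = p := by
    rintro p ⟨k, f, e, ha, hb, hp⟩
    have hf : Kind.operad.Allowed f := bijective_of_proj_mem hη (ha ▸ hab.2)
    refine ⟨C.pseudo.Mor.map f hf e, ?_, ?_, (φ.mor.app_map f hf e).trans hp⟩
    · exact (congrArg η.laplazaOb.app (C.pseudo.src.app_map f hf e)).trans
        ((η.laplazaOb.app_map f hf _).trans ha)
    · exact (congrArg η.laplazaOb.app (C.pseudo.tgt.app_map f hf e)).trans
        ((η.laplazaOb.app_map f hf _).trans hb)
  obtain ⟨e, ha, hb, rfl⟩ := key h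
  obtain ⟨e', ha', hb', rfl⟩ := key h'
  exact congrArg φ.mor.app (pseudo_mor_ext (laplazaOb_injective hη (ha.trans ha'.symm))
    (laplazaOb_injective hη (hb.trans hb'.symm)))

end OpSystem.Hom.Lifts

namespace OpSystem.Hom

/-- The arrows of `G_S` have values in `E`: a coherent pair comes from an arrow of `C'`. -/
theorem exists_graph_arrow (hη : IsFreeTheoryOn η) {ψ : Hom η.laplazaSet.words E.Ob}
    (hψ : ∀ (n : ℕ) (t : C.opWords.word n), ψ.app (η.laplazaOb.app t) = φ.ob.app t) {n : ℕ}
    (g : η.laplazaSet.graph.Mor n) :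
    ∃ p : E.Mor.word n, η.Lifts φ (η.laplazaSet.graph.src g) (η.laplazaSet.graph.tgt g) p ∧
      E.src.app p = ψ.app (η.laplazaSet.graph.src g) ∧
      E.tgt.app p = ψ.app (η.laplazaSet.graph.tgt g) ∧
      (η.laplazaSet.graph.src g = η.laplazaSet.graph.tgt g →
        p = E.idm.app (ψ.app (η.laplazaSet.graph.src g))) := by
  obtain ⟨⟨a, b⟩, (hab : a = b ∨ η.laplazaSet.Coherent a b)⟩ := g
  change ∃ p : E.Mor.word n, η.Lifts φ a b p ∧ E.src.app p = ψ.app a ∧ E.tgt.app p = ψ.app b ∧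
    (a = b → p = E.idm.app (ψ.app a))
  obtain rfl | h := hab
  · exact ⟨_, Lifts.idm hη hψ a, E.src_idm _, E.tgt_idm _, fun _ => rfl⟩
  · obtain ⟨e, rfl, rfl⟩ := exists_arrow_of_coherent hη h
    refine ⟨_, Lifts.of_arrow e, (φ.src_mor e).trans (hψ _ _).symm,
      (φ.tgt_mor e).trans (hψ _ _).symm, fun heq => ?_⟩
    refine Lifts.unique hη h (Lifts.of_arrow e) ?_
    exact heq ▸ Lifts.idm hη hψ (η.laplazaOb.app (C.pseudo.src.app e))

/-- Every morphism of categorical operads on `C'` extends along `κ`: all values in `E` of arrows of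
`F_S` are of the form described by `Lifts`, and hence the relations of `T'_S` hold in `E`. -/
theorem exists_extension (hη : IsFreeTheoryOn η) (φ : CatSystem.Hom C.pseudo E.toOperad) :
    ∃ ψ : CatSystem.Hom η.laplazaSet.pseudo E, ψ.toOperad.comp η.comparison = φ := by
  obtain ⟨ψ₀, hψ₀⟩ := exists_laplazaOb_extension hη φ.ob
  -- The last condition covers the pairs `(a, a)`, which are both identities and instances of `ι`.
  choose arr harr hs ht hid using fun n (g : η.laplazaSet.graph.Mor n) =>
    exists_graph_arrow hη hψ₀ g
  let Φ : CatSystem.Hom η.laplazaSet.graph.free E :=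
    GraphicalPreSystem.freeLift ψ₀ (arr _) (hs _) (ht _) fun a => hid _ _ rfl
  have hΦ : ∀ {n : ℕ} (p : η.laplazaSet.graph.free.Mor.word n),
      η.Lifts φ (η.laplazaSet.graph.free.src.app p) (η.laplazaSet.graph.free.tgt.app p)
        (Φ.mor.app p) := by
    intro n p
    induction p using GraphicalPreSystem.free_induction with
    | arrow g =>
      have e : Φ.mor.app (η.laplazaSet.graph.arrow g) = arr _ g :=
        GraphicalPreSystem.freeLift_arrow ψ₀ (arr _) (hs _) (ht _) _ g
      rw [e, GraphicalPreSystem.src_arrow, GraphicalPreSystem.tgt_arrow]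
      exact harr _ g
    | idm a =>
      exact (Lifts.idm hη hψ₀ a).of_eq (η.laplazaSet.graph.free.src_idm a).symm
        (η.laplazaSet.graph.free.tgt_idm a).symm (Φ.mor_idm a).symm
    | vcomp p q h hp hq =>
      have h' : E.tgt.app (Φ.mor.app p) = E.src.app (Φ.mor.app q) := by
        rw [Φ.tgt_mor, Φ.src_mor, h]
      rw [Φ.mor_vcomp p q h h', CatSystem.src_vcomp, CatSystem.tgt_vcomp]
      exact Lifts.vcomp hη hp (h ▸ hq) h'
    | map f hf p ih =>
      rw [Φ.mor.app_map, OpSystem.Hom.app_map, OpSystem.Hom.app_map]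
      exact Lifts.map f ih
    | comp p ps ih ihs =>
      rw [Φ.mor.app_comp, OpSystem.Hom.app_comp, OpSystem.Hom.app_comp]
      exact Lifts.comp ih ihs
  have hcoh : ∀ {n : ℕ} {p q : η.laplazaSet.graph.free.Mor.word n},
      η.laplazaSet.graph.free.src.app p = η.laplazaSet.graph.free.src.app q →
      η.laplazaSet.graph.free.tgt.app p = η.laplazaSet.graph.free.tgt.app q →
      η.laplazaSet.Coherent (η.laplazaSet.graph.free.src.app p)
        (η.laplazaSet.graph.free.tgt.app p) → Φ.mor.app p = Φ.mor.app q := by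
    intro n p q hs ht h
    have hq := hΦ q
    rw [← hs, ← ht] at hq
    exact Lifts.unique hη h (hΦ p) hq
  have hR : ∀ n (p q : η.laplazaSet.graph.free.toPre.Mor n), η.laplazaSet.CohRel n p q →
      η.laplazaSet.graph.free.toPre.src p = η.laplazaSet.graph.free.toPre.src q →
      η.laplazaSet.graph.free.toPre.tgt p = η.laplazaSet.graph.free.toPre.tgt q →
      Φ.toPre.mor p = Φ.toPre.mor q := by
    -- The relation `ι_{a,b} = ι_{b,a}⁻¹` is also one between parallel arrows of coherent objects.
    rintro n _ _ (⟨a, b, h, h', e⟩ | ⟨p, q, hs, ht, h⟩) hs' ht'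
    · refine hcoh hs' ht' ?_
      change η.laplazaSet.graph.free.src.app _ = η.laplazaSet.graph.free.src.app _ at hs'
      change η.laplazaSet.graph.free.tgt.app _ = η.laplazaSet.graph.free.tgt.app _ at ht'
      have hsrc := hs'.trans (η.laplazaSet.graph.free.src_idm a)
      have htgt := ht'.trans (η.laplazaSet.graph.free.tgt_idm a)
      rw [hsrc, htgt]
      exact ⟨rfl, h.2⟩
    · exact hcoh hs ht h
  refine ⟨Φ.toPre.quotLift hR, CatSystem.Hom.eq_of_app_eq hψ₀ fun n e => ?_⟩
  have hcl : (Φ.toPre.quotLift hR).mor.app (η.comparisonMor e) = Φ.mor.app (η.laplazaSet.iota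
      (η.laplazaOb.app (C.pseudo.src.app e)) (η.laplazaOb.app (C.pseudo.tgt.app e))
      (coherent_laplazaOb e.2)) := Φ.toPre.quotLift_cls hR _
  refine hcl.trans (Lifts.unique hη (coherent_laplazaOb e.2) ?_ (Lifts.of_arrow e))
  exact (hΦ (η.laplazaSet.iota (η.laplazaOb.app (C.pseudo.src.app e))
    (η.laplazaOb.app (C.pseudo.tgt.app e)) (coherent_laplazaOb e.2))).of_eq
      (GraphicalPreSystem.src_arrow _) (GraphicalPreSystem.tgt_arrow _) rfl

theorem extension_unique (hη : IsFreeTheoryOn η) {ψ ψ' : CatSystem.Hom η.laplazaSet.pseudo E}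
    (h : ψ.toOperad.comp η.comparison = ψ'.toOperad.comp η.comparison) : ψ = ψ' := by
  have hob : ∀ {n : ℕ} (a : η.laplazaSet.words.word n), ψ.ob.app a = ψ'.ob.app a := fun a =>
    app_eq_of_laplazaOb η (fun n t =>
      congrArg (fun χ : CatSystem.Hom C.pseudo E.toOperad => χ.ob.app t) h) a
  have hfree : ψ.comp (η.laplazaSet.graph.free.quotProj η.laplazaSet.CohRel) =
      ψ'.comp (η.laplazaSet.graph.free.quotProj η.laplazaSet.CohRel) := by
    refine GraphicalPreSystem.free_hom_ext (fun n a => hob a) ?_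
    rintro n ⟨⟨a, b⟩, hab⟩
    by_cases heq : a = b
    · subst heq
      have e : η.laplazaSet.graph.arrow ⟨(a, a), hab⟩ = η.laplazaSet.graph.free.idm.app a :=
        GraphicalPreSystem.arrow_idm (G := η.laplazaSet.graph) a
      rw [e]
      exact (ψ.mor_idm a).trans ((congrArg E.idm.app (hob a)).trans (ψ'.mor_idm a).symm)
    · obtain ⟨e, rfl, rfl⟩ := exists_arrow_of_coherent hη (hab.resolve_left heq)
      exact congrArg (fun χ : CatSystem.Hom C.pseudo E.toOperad => χ.mor.app e) h
  refine CatSystem.Hom.eq_of_app_eq (fun n a => hob a) fun n p => ?_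
  obtain ⟨q, rfl⟩ := CatSystem.quotProj_surjective p
  exact congrArg (fun χ : CatSystem.Hom η.laplazaSet.graph.free E => χ.mor.app q) hfree

/-- `T'_S` is the free categorical theory on `C'`, tested in every universe. -/
theorem isFreeCatTheoryOn_comparison (hη : IsFreeTheoryOn η) :
    IsFreeCatTheoryOn.{u, u, v} η.comparison := by
  intro E φ
  obtain ⟨ψ, hψ⟩ := exists_extension hη φ
  exact ⟨ψ, hψ, fun ψ' hψ' => extension_unique hη (hψ'.trans hψ.symm)⟩

end OpSystem.Hom

end Extension

/-- Free categorical theories on the same categorical operad are canonically isomorphic. -/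
theorem IsFreeCatTheoryOn.isIso {C : CatOperad.{u}} {F G : CatTheory.{u}}
    {j : CatSystem.Hom C F.toOperad} {κ : CatSystem.Hom C G.toOperad}
    (hj : IsFreeCatTheoryOn.{u, u, u} j) (hκ : IsFreeCatTheoryOn.{u, u, u} κ)
    {φ : CatSystem.Hom F G} (h : φ.toOperad.comp j = κ) : φ.IsIso := by
  obtain ⟨ψ, hψ, -⟩ := hκ F j
  refine ⟨ψ, (hj F j).unique ?_ rfl, (hκ G κ).unique ?_ rfl⟩
  · exact (congrArg ψ.toOperad.comp h).trans hψ
  · exact (congrArg φ.toOperad.comp hψ).trans h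

theorem proposition2p6 (C : Operad.{u}) (T : Theory.{u}) (η : OpSystem.Hom C T.toOperad)
    (hη : IsFreeTheoryOn η) :
    ∃ κ : CatSystem.Hom C.pseudo η.laplazaSet.pseudo.toOperad,
      -- `κ` is the unique morphism that is the evident one on the generators of the objects
      ((∀ (n : ℕ) (c : C.word n), κ.ob.app (OpSystem.free.gen c) = η.laplazaGen c) ∧
        ∀ κ' : CatSystem.Hom C.pseudo η.laplazaSet.pseudo.toOperad,
          (∀ (n : ℕ) (c : C.word n), κ'.ob.app (OpSystem.free.gen c) = η.laplazaGen c) →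
            κ' = κ) ∧
      -- it exhibits `T'_S` as the free categorical theory on `C'`
      IsFreeCatTheoryOn.{u, u, u'} κ ∧
      -- the canonical map from any free categorical theory on `C'` to `T'_S` is an isomorphism
      (∀ (F : CatTheory.{u}) (j : CatSystem.Hom C.pseudo F.toOperad),
        IsFreeCatTheoryOn.{u, u, u} j →
          (∃! φ : CatSystem.Hom F η.laplazaSet.pseudo, φ.toOperad.comp j = κ) ∧
          ∀ φ : CatSystem.Hom F η.laplazaSet.pseudo, φ.toOperad.comp j = κ → φ.IsIso) ∧
      -- restriction along `κ` identifies pseudo `(T, S)`-algebras with pseudo `C`-algebras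
      ∀ (X : Type w) [CategoryTheory.Category.{v} X],
        Function.Bijective fun A : PseudoAlgebra η.laplazaSet X =>
          (A.toOperad.comp κ : PseudoOperadAlgebra C X) := by
  refine ⟨η.comparison, ⟨fun _ _ => rfl, fun _ h => η.eq_comparison h⟩,
    OpSystem.Hom.isFreeCatTheoryOn_comparison hη,
    fun F j hj => ⟨hj _ η.comparison, fun φ h => hj.isIso
      (OpSystem.Hom.isFreeCatTheoryOn_comparison hη) h⟩, fun X _ => ⟨fun A A' h => ?_, fun B => ?_⟩⟩
  · exact OpSystem.Hom.extension_unique hη h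
  · exact OpSystem.Hom.exists_extension hη B
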